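/- Let $n\ge 2$, $1<p<n$, $\nu>0$ and $1<\sigma<+\infty$. Let $\Omega\subset\mathbb R^n$ be a bounded open set, let $f:\Omega\times\mathbb R^n\to\mathbb R$ be a Carathéodory function and let $a:\Omega\to[0,+\infty)$ be such that $$\nu |z|^p\ln^p(e+|z|)-a(x)\le f(x,z)\qquad\text{for a.e. }x\in\Omega\text{ and all }z\in\mathbb R^n .$$ Let $u_*\in W^{1,1}(\Omega)$ be such that $a$ and $x\mapsto f(x,Du_*(x))$ belong to $L^\sigma(\Omega)$, and let $$\mathcal C=\{w\in u_*+W^{1,1}_0(\Omega):\ f(x,Dw(x))\in L^1(\Omega)\}.$$ Let $u\in\mathcal C$ be a minimizer, that is, $\int_\Omega f(x,Du)\,dx\le\int_\Omega f(x,Dw)\,dx$ for all $w\in\mathcal C$. Then: - if $\sigma>\frac np$, then $|u-u_*|\ln(e+|u-u_*|)\in L^\infty(\Omega)$; - if $\sigma=\frac np$, then there is a constant $\tilde\tau>0$, depending only on $n,p,\nu$ and $\|f(x,Du_*)+a\|_{L^\sigma(\Omega)}$, such that $e^{\frac{|u-u_*|}{2\tilde\tau}}\in L^1(\Omega)$;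 - if $\sigma<\frac np$, then $|u-u_*|\ln(e+|u-u_*|)\in L_w^{\frac{np\sigma}{n-p\sigma}}(\Omega)$. Here $L_w^m(\Omega)$ is the Marcinkiewicz space of all measurable $h$ on $\Omega$ for which there is a constant $\gamma$ with $|\{x\in\Omega:|h(x)|>\lambda\}|\le\gamma\lambda^{-m}$ for all $\lambda>0$. -/

import Mathlib

open MeasureTheory Filter Topology
open scoped ENNReal ContDiff Gradient

/-- Test functions `C_c^∞(Ω)`. -/
structure IsTestFunction {n : ℕ} (Ω : Set (EuclideanSpace ℝ (Fin n)))
    (φ : EuclideanSpace ℝ (Fin n) → ℝ) : Prop where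
  smooth : ContDiff ℝ ∞ φ
  compactSupport : HasCompactSupport φ
  tsupport_subset : tsupport φ ⊆ Ω

/-- `G` is a weak gradient of `u` on `Ω`: both are locally integrable on `Ω` and
`∫_Ω u ∇φ = - ∫_Ω φ G` for all `φ ∈ C_c^∞(Ω)`. -/
structure HasWeakGradient {n : ℕ} (Ω : Set (EuclideanSpace ℝ (Fin n)))
    (u : EuclideanSpace ℝ (Fin n) → ℝ)
    (G : EuclideanSpace ℝ (Fin n) → EuclideanSpace ℝ (Fin n)) : Prop where
  locallyIntegrableOn : LocallyIntegrableOn u Ω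
  grad_locallyIntegrableOn : LocallyIntegrableOn G Ω
  integral_eq : ∀ φ : EuclideanSpace ℝ (Fin n) → ℝ, IsTestFunction Ω φ →
    ∫ x in Ω, u x • ∇ φ x = - ∫ x in Ω, φ x • G x

open Classical in
/-- The weak gradient `Du` on `Ω`, determined almost everywhere on `Ω` when `Ω` is open
and `u` has a weak gradient (and `0` by convention if it has none). -/
noncomputable def weakGradient {n : ℕ} (Ω : Set (EuclideanSpace ℝ (Fin n)))
    (u : EuclideanSpace ℝ (Fin n) → ℝ) : EuclideanSpace ℝ (Fin n) → EuclideanSpace ℝ (Fin n) :=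
  if h : ∃ G, HasWeakGradient Ω u G then h.choose else 0

/-- Well-definedness: any weak gradient of `u` agrees with `weakGradient Ω u` a.e. on `Ω`. -/
theorem HasWeakGradient.weakGradient_ae_eq {n : ℕ} {Ω : Set (EuclideanSpace ℝ (Fin n))}
    (hΩ : IsOpen Ω) {u : EuclideanSpace ℝ (Fin n) → ℝ}
    {G : EuclideanSpace ℝ (Fin n) → EuclideanSpace ℝ (Fin n)} (hG : HasWeakGradient Ω u G) :
    weakGradient Ω u =ᵐ[volume.restrict Ω] G := by
  have hex : ∃ G, HasWeakGradient Ω u G := ⟨G, hG⟩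
  have hH : HasWeakGradient Ω u (weakGradient Ω u) := by
    unfold weakGradient
    rw [dif_pos hex]
    exact hex.choose_spec
  have key := hΩ.ae_eq_zero_of_integral_contDiff_smul_eq_zero (μ := volume)
    (hH.grad_locallyIntegrableOn.sub hG.grad_locallyIntegrableOn) (by
      intro φ h1 h2 h3
      have hint : ∀ {F : EuclideanSpace ℝ (Fin n) → EuclideanSpace ℝ (Fin n)},
          LocallyIntegrableOn F Ω → IntegrableOn (fun x => φ x • F x) Ω := by
        intro F hF
        have h4 : IntegrableOn F (tsupport φ) := hF.integrableOn_compact_subset h3 h2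
        have h5 : IntegrableOn (fun x => φ x • F x) (tsupport φ) :=
          h4.continuousOn_smul h1.continuous.continuousOn h2
        have h6 : Integrable (fun x => φ x • F x) := by
          rwa [integrableOn_iff_integrable_of_support_subset] at h5
          intro x hx
          by_contra hx'
          exact hx (by simp [image_eq_zero_of_notMem_tsupport hx'])
        exact h6.integrableOn
      have h7 := hH.integral_eq φ ⟨h1, h2, h3⟩
      rw [hG.integral_eq φ ⟨h1, h2, h3⟩, neg_inj] at h7
      rw [← setIntegral_eq_integral_of_forall_compl_eq_zero (s := Ω)]
      · simp only [Pi.sub_apply, smul_sub]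
        rw [integral_sub (hint hH.grad_locallyIntegrableOn) (hint hG.grad_locallyIntegrableOn),
          h7, sub_self]
      · intro x hx
        have : φ x = 0 := image_eq_zero_of_notMem_tsupport fun h => hx (h3 h)
        simp [this])
  refine (ae_restrict_iff' hΩ.measurableSet).2 ?_
  filter_upwards [key] with x hx hxΩ
  exact sub_eq_zero.1 (hx hxΩ)

/-- The Sobolev space `W^{1,1}(Ω)`. -/
def MemW11 {n : ℕ} (Ω : Set (EuclideanSpace ℝ (Fin n)))
    (u : EuclideanSpace ℝ (Fin n) → ℝ) : Prop :=
  IntegrableOn u Ω ∧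
    ∃ G : EuclideanSpace ℝ (Fin n) → EuclideanSpace ℝ (Fin n),
      HasWeakGradient Ω u G ∧ IntegrableOn G Ω

/-- The Sobolev space `W_0^{1,1}(Ω)`: the closure of `C_c^∞(Ω)` in `W^{1,1}(Ω)`. -/
def MemW011 {n : ℕ} (Ω : Set (EuclideanSpace ℝ (Fin n)))
    (v : EuclideanSpace ℝ (Fin n) → ℝ) : Prop :=
  MemW11 Ω v ∧
    ∃ φ : ℕ → EuclideanSpace ℝ (Fin n) → ℝ, (∀ k, IsTestFunction Ω (φ k)) ∧
      Tendsto (fun k => eLpNorm (fun x => φ k x - v x) 1 (volume.restrict Ω)) atTop (𝓝 0) ∧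
      Tendsto (fun k => eLpNorm (fun x => ∇ (φ k) x - weakGradient Ω v x) 1
        (volume.restrict Ω)) atTop (𝓝 0)

/-- `f : Ω × ℝⁿ → ℝ` is a Carathéodory function. -/
structure IsCaratheodory {n : ℕ} (Ω : Set (EuclideanSpace ℝ (Fin n)))
    (f : EuclideanSpace ℝ (Fin n) → EuclideanSpace ℝ (Fin n) → ℝ) : Prop where
  measurable : ∀ z, AEMeasurable (fun x => f x z) (volume.restrict Ω)
  continuous : ∀ᵐ x ∂(volume.restrict Ω), Continuous (f x)

/-- The variational integral `J(u; Ω) = ∫_Ω f(x, Du(x)) dx`. -/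
noncomputable def variationalIntegral {n : ℕ} (Ω : Set (EuclideanSpace ℝ (Fin n)))
    (f : EuclideanSpace ℝ (Fin n) → EuclideanSpace ℝ (Fin n) → ℝ)
    (u : EuclideanSpace ℝ (Fin n) → ℝ) : ℝ :=
  ∫ x in Ω, f x (weakGradient Ω u x)

/-- The competing functions: `w ∈ u_* + W_0^{1,1}(Ω)` with `f(x, Dw(x)) ∈ L¹(Ω)`. -/
def competitors {n : ℕ} (Ω : Set (EuclideanSpace ℝ (Fin n)))
    (f : EuclideanSpace ℝ (Fin n) → EuclideanSpace ℝ (Fin n) → ℝ)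
    (ustar : EuclideanSpace ℝ (Fin n) → ℝ) : Set (EuclideanSpace ℝ (Fin n) → ℝ) :=
  {w | MemW011 Ω (fun x => w x - ustar x) ∧
    IntegrableOn (fun x => f x (weakGradient Ω w x)) Ω}

/-- `u` is a minimizer of `J(·; Ω)` among the competing functions. -/
def IsMinimizer {n : ℕ} (Ω : Set (EuclideanSpace ℝ (Fin n)))
    (f : EuclideanSpace ℝ (Fin n) → EuclideanSpace ℝ (Fin n) → ℝ)
    (ustar u : EuclideanSpace ℝ (Fin n) → ℝ) : Prop :=
  u ∈ competitors Ω f ustar ∧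
    ∀ w ∈ competitors Ω f ustar, variationalIntegral Ω f u ≤ variationalIntegral Ω f w

/-- The Marcinkiewicz (weak Lebesgue) space `L_w^m(Ω)`. -/
def MemMarcinkiewicz {n : ℕ} (Ω : Set (EuclideanSpace ℝ (Fin n))) (m : ℝ)
    (h : EuclideanSpace ℝ (Fin n) → ℝ) : Prop :=
  AEMeasurable h (volume.restrict Ω) ∧
    ∃ γ : ℝ, ∀ l : ℝ, 0 < l → volume {x ∈ Ω | l < |h x|} ≤ ENNReal.ofReal (γ / l ^ m)

/-! Put v = u - u_* and A_k = {|v| > k}. The competitor u_* + T_k(v), with T_k the truncation at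
levels ±k, has the gradient of u off A_k and that of u_* on A_k. Minimality therefore gives ∫_{A_k}
f(x,Du) ≤ ∫_{A_k} f(x,Du_*) (`IsMinimizer.setIntegral_le`). By coercivity both |Du| ln(e+|Du|) and
|Du_*| ln(e+|Du_*|) have their p-th power on A_k controlled by f(x,Du_*) + a, whose L^σ norm is M.
Hölder then bounds their L¹ norms on A_k by (M/ν)^{1/p} |A_k|^{1-1/(pσ)}.

To return to |Du| itself, use t ≤ s + t ln(e+t)/ln(e+s) with a free parameter s ≥ 0. The W_0^{1,1}
Sobolev inequality for v - T_k(v) and Chebyshev then give, for 0 < k < h, (h-k) |A_h|^{1-1/n} ≤ 2S (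
s|A_k| + K |A_k|^{1-1/(pσ)} / ln(e+s) ), with K = (M/ν)^{1/p}, which is
`IsMinimizer.level_estimate`.

The rest concerns the real function φ(k) = |A_k|. With s = 0 this is Stampacchia's inequality: φ
vanishes at a finite level if pσ > n, and decays exponentially if pσ = n. If pσ < n, take s to be a
small power of k. The weak L¹ bound k φ(k) ≤ ‖v‖₁ absorbs the term s φ(k), while ln(e+s) is
comparable to ln(e+k). This gives k ln(e+k) φ(2k)^{1-1/n} ≤ D φ(k)^{1-1/(pσ)}, and iterating over
dyadic levels yields the Marcinkiewicz bound for |v| ln(e+|v|). -/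

section Sobolev

variable {n : ℕ} {Ω : Set (EuclideanSpace ℝ (Fin n))}

/-! ### Calculus of test functions -/

theorem norm_gradient_eq_norm_fderiv (φ : EuclideanSpace ℝ (Fin n) → ℝ)
    (x : EuclideanSpace ℝ (Fin n)) : ‖∇ φ x‖ = ‖fderiv ℝ φ x‖ := by
  simp [gradient]

theorem inner_gradient_eq_fderiv (φ : EuclideanSpace ℝ (Fin n) → ℝ)
    (x e : EuclideanSpace ℝ (Fin n)) : inner ℝ (∇ φ x) e = fderiv ℝ φ x e := by
  simp [gradient]

namespace IsTestFunction

variable {φ ψ : EuclideanSpace ℝ (Fin n) → ℝ}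

theorem continuous_gradient (h : IsTestFunction Ω φ) : Continuous (∇ φ) := by
  have h1 : Continuous (fderiv ℝ φ) := h.smooth.continuous_fderiv (by simp)
  exact (InnerProductSpace.toDual ℝ _).symm.continuous.comp h1

theorem hasCompactSupport_gradient (h : IsTestFunction Ω φ) : HasCompactSupport (∇ φ) := by
  have h1 := h.compactSupport.fderiv (𝕜 := ℝ)
  exact h1.comp_left (g := (InnerProductSpace.toDual ℝ _).symm) (by simp)

theorem integrable (h : IsTestFunction Ω φ) : Integrable φ :=
  h.smooth.continuous.integrable_of_hasCompactSupport h.compactSupport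

theorem integrable_gradient (h : IsTestFunction Ω φ) : Integrable (∇ φ) :=
  h.continuous_gradient.integrable_of_hasCompactSupport h.hasCompactSupport_gradient

theorem eq_zero_of_notMem (h : IsTestFunction Ω φ) {x : EuclideanSpace ℝ (Fin n)} (hx : x ∉ Ω) :
    φ x = 0 :=
  image_eq_zero_of_notMem_tsupport fun h' => hx (h.tsupport_subset h')

theorem gradient_eq_zero_of_notMem (h : IsTestFunction Ω φ) {x : EuclideanSpace ℝ (Fin n)}
    (hx : x ∉ Ω) : ∇ φ x = 0 := by
  have h1 : fderiv ℝ φ x = 0 := by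
    by_contra h2
    exact hx (h.tsupport_subset (support_fderiv_subset ℝ h2))
  simp [gradient, h1]

theorem sub (hφ : IsTestFunction Ω φ) (hψ : IsTestFunction Ω ψ) :
    IsTestFunction Ω (fun x => φ x - ψ x) where
  smooth := hφ.smooth.sub hψ.smooth
  compactSupport := hφ.compactSupport.sub hψ.compactSupport
  tsupport_subset := (tsupport_sub φ ψ).trans
    (Set.union_subset hφ.tsupport_subset hψ.tsupport_subset)

theorem comp_left (hφ : IsTestFunction Ω φ) {η : ℝ → ℝ} (hη : ContDiff ℝ ∞ η) (h0 : η 0 = 0) :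
    IsTestFunction Ω (fun x => η (φ x)) where
  smooth := hη.comp hφ.smooth
  compactSupport := hφ.compactSupport.comp_left h0
  tsupport_subset := (closure_mono fun x hx => by
    intro h
    simp [h, h0] at hx).trans hφ.tsupport_subset

theorem differentiable (hφ : IsTestFunction Ω φ) : Differentiable ℝ φ :=
  hφ.smooth.differentiable (by simp)

theorem gradient_sub (hφ : IsTestFunction Ω φ) (hψ : IsTestFunction Ω ψ)
    (x : EuclideanSpace ℝ (Fin n)) :
    ∇ (fun x => φ x - ψ x) x = ∇ φ x - ∇ ψ x := by
  simp only [gradient]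
  rw [fderiv_fun_sub hφ.differentiable.differentiableAt hψ.differentiable.differentiableAt, map_sub]

theorem gradient_comp_left (hφ : IsTestFunction Ω φ) {η : ℝ → ℝ} (hη : Differentiable ℝ η)
    (x : EuclideanSpace ℝ (Fin n)) :
    ∇ (fun x => η (φ x)) x = deriv η (φ x) • ∇ φ x := by
  have h1 : HasFDerivAt (fun x => η (φ x)) (deriv η (φ x) • fderiv ℝ φ x) x :=
    (hη (φ x)).hasDerivAt.comp_hasFDerivAt x hφ.differentiable.differentiableAt.hasFDerivAt
  simp only [gradient]
  rw [h1.fderiv, map_smulₛₗ]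
  simp

theorem integral_smul_gradient (hφ : IsTestFunction Ω φ) (hψ : IsTestFunction Ω ψ) :
    ∫ x in Ω, φ x • ∇ ψ x = - ∫ x in Ω, ψ x • ∇ φ x := by
  rw [setIntegral_eq_integral_of_forall_compl_eq_zero
      (fun x hx => by simp [hφ.eq_zero_of_notMem hx]),
    setIntegral_eq_integral_of_forall_compl_eq_zero
      (fun x hx => by simp [hψ.eq_zero_of_notMem hx])]
  have i1 : Integrable (fun x => φ x • ∇ ψ x) :=
    (hφ.smooth.continuous.smul hψ.continuous_gradient).integrable_of_hasCompactSupport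
      hφ.compactSupport.smul_right
  have i2 : Integrable (fun x => ψ x • ∇ φ x) :=
    (hψ.smooth.continuous.smul hφ.continuous_gradient).integrable_of_hasCompactSupport
      hψ.compactSupport.smul_right
  -- Pairing with a fixed vector e reduces the vector identity to scalar integration by parts in the
  -- direction e.
  refine ext_inner_right ℝ fun e => ?_
  rw [inner_neg_left, real_inner_comm, real_inner_comm e, ← integral_inner i1, ← integral_inner i2]
  have e1 : ∀ x, inner ℝ e (φ x • ∇ ψ x) = φ x * fderiv ℝ ψ x e := fun x => by
    rw [real_inner_comm, inner_smul_left, inner_gradient_eq_fderiv]; simp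
  have e2 : ∀ x, inner ℝ e (ψ x • ∇ φ x) = fderiv ℝ φ x e * ψ x := fun x => by
    rw [real_inner_comm, inner_smul_left, inner_gradient_eq_fderiv]; simp [mul_comm]
  simp only [e1, e2]
  refine integral_mul_fderiv_eq_neg_fderiv_mul_of_integrable ?_ ?_ ?_
    (fun x _ => hφ.differentiable x) (fun x _ => hψ.differentiable x)
  · simpa only [e2] using i2.const_inner (𝕜 := ℝ) e
  · simpa only [e1] using i1.const_inner (𝕜 := ℝ) e
  · exact (hφ.smooth.continuous.mul hψ.smooth.continuous).integrable_of_hasCompactSupport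
      hφ.compactSupport.mul_right

theorem integrableOn_smul_gradient (hψ : IsTestFunction Ω ψ)
    {v : EuclideanSpace ℝ (Fin n) → ℝ} (hv : LocallyIntegrableOn v Ω) :
    IntegrableOn (fun x => v x • ∇ ψ x) Ω := by
  have h4 := hv.integrableOn_compact_subset hψ.tsupport_subset hψ.compactSupport
  have h5 : IntegrableOn (fun x => v x • ∇ ψ x) (tsupport ψ) :=
    h4.smul_continuousOn hψ.continuous_gradient.continuousOn hψ.compactSupport
  refine Integrable.integrableOn ?_
  rwa [integrableOn_iff_integrable_of_support_subset] at h5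
  intro x hx
  by_contra hx'
  refine hx ?_
  have : fderiv ℝ ψ x = 0 := by
    by_contra h2
    exact hx' (support_fderiv_subset ℝ h2)
  simp [gradient, this]

theorem integrableOn_smul (hψ : IsTestFunction Ω ψ)
    {G : EuclideanSpace ℝ (Fin n) → EuclideanSpace ℝ (Fin n)} (hG : LocallyIntegrableOn G Ω) :
    IntegrableOn (fun x => ψ x • G x) Ω := by
  have h4 := hG.integrableOn_compact_subset hψ.tsupport_subset hψ.compactSupport
  have h5 : IntegrableOn (fun x => ψ x • G x) (tsupport ψ) :=
    h4.continuousOn_smul hψ.smooth.continuous.continuousOn hψ.compactSupport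
  refine Integrable.integrableOn ?_
  rwa [integrableOn_iff_integrable_of_support_subset] at h5
  intro x hx
  by_contra hx'
  exact hx (by simp [image_eq_zero_of_notMem_tsupport hx'])

end IsTestFunction

/-! ### The space W_0^{1,1}(Ω) as a closed set of pairs (function, gradient) -/

/-- `v` and `G` are the limits in `L¹(Ω)` of test functions and of their gradients. -/
structure SobolevZero (Ω : Set (EuclideanSpace ℝ (Fin n)))
    (v : EuclideanSpace ℝ (Fin n) → ℝ)
    (G : EuclideanSpace ℝ (Fin n) → EuclideanSpace ℝ (Fin n)) : Prop where
  integrableOn : IntegrableOn v Ω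
  integrableOn_grad : IntegrableOn G Ω
  approx : ∀ ε : ℝ≥0∞, ε ≠ 0 → ∃ φ, IsTestFunction Ω φ ∧
    eLpNorm (fun x => φ x - v x) 1 (volume.restrict Ω) ≤ ε ∧
    eLpNorm (fun x => ∇ φ x - G x) 1 (volume.restrict Ω) ≤ ε

namespace SobolevZero

variable {v w : EuclideanSpace ℝ (Fin n) → ℝ}
  {G H : EuclideanSpace ℝ (Fin n) → EuclideanSpace ℝ (Fin n)}

/-- A closure is closed (an ε/2 argument). Differences, chain rule and truncation are all obtained
from it by approximation. -/
theorem of_tendsto (hv : IntegrableOn v Ω) (hG : IntegrableOn G Ω)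
    {V : ℕ → EuclideanSpace ℝ (Fin n) → ℝ}
    {F : ℕ → EuclideanSpace ℝ (Fin n) → EuclideanSpace ℝ (Fin n)}
    (h : ∀ k, SobolevZero Ω (V k) (F k))
    (h1 : Tendsto (fun k => eLpNorm (fun x => V k x - v x) 1 (volume.restrict Ω)) atTop (𝓝 0))
    (h2 : Tendsto (fun k => eLpNorm (fun x => F k x - G x) 1 (volume.restrict Ω)) atTop (𝓝 0)) :
    SobolevZero Ω v G := by
  refine ⟨hv, hG, fun ε hε => ?_⟩
  have hε2 : 0 < ε / 2 := ENNReal.half_pos hε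
  obtain ⟨k, hk1, hk2⟩ := ((h1.eventually_le_const hε2).and (h2.eventually_le_const hε2)).exists
  obtain ⟨φ, hφ, hφ1, hφ2⟩ := (h k).approx (ε / 2) hε2.ne'
  refine ⟨φ, hφ, ?_, ?_⟩
  · have : (fun x => φ x - v x) = (fun x => φ x - V k x) + fun x => V k x - v x := by
      ext x; simp
    rw [this]
    refine (eLpNorm_add_le ?_ ?_ le_rfl).trans ((add_le_add hφ1 hk1).trans (ENNReal.add_halves ε).le)
    · exact (hφ.integrable.integrableOn.sub (h k).integrableOn).aestronglyMeasurable
    · exact ((h k).integrableOn.sub hv).aestronglyMeasurable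
  · have : (fun x => ∇ φ x - G x) = (fun x => ∇ φ x - F k x) + fun x => F k x - G x := by
      ext x; simp
    rw [this]
    refine (eLpNorm_add_le ?_ ?_ le_rfl).trans ((add_le_add hφ2 hk2).trans (ENNReal.add_halves ε).le)
    · exact (hφ.integrable_gradient.integrableOn.sub (h k).integrableOn_grad).aestronglyMeasurable
    · exact ((h k).integrableOn_grad.sub hG).aestronglyMeasurable

theorem of_isTestFunction {φ : EuclideanSpace ℝ (Fin n) → ℝ} (hφ : IsTestFunction Ω φ) :
    SobolevZero Ω φ (∇ φ) :=
  ⟨hφ.integrable.integrableOn, hφ.integrable_gradient.integrableOn,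
    fun ε _ => ⟨φ, hφ, by simp, by simp⟩⟩

theorem exists_seq (h : SobolevZero Ω v G) :
    ∃ φ : ℕ → EuclideanSpace ℝ (Fin n) → ℝ, (∀ k, IsTestFunction Ω (φ k)) ∧
      Tendsto (fun k => eLpNorm (fun x => φ k x - v x) 1 (volume.restrict Ω)) atTop (𝓝 0) ∧
      Tendsto (fun k => eLpNorm (fun x => ∇ (φ k) x - G x) 1 (volume.restrict Ω)) atTop (𝓝 0) := by
  choose φ h1 h2 h3 using fun k : ℕ => h.approx ((k : ℝ≥0∞)⁻¹) (by simp)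
  exact ⟨φ, h1,
    tendsto_of_tendsto_of_tendsto_of_le_of_le tendsto_const_nhds
      ENNReal.tendsto_inv_nat_nhds_zero (fun _ => zero_le) h2,
    tendsto_of_tendsto_of_tendsto_of_le_of_le tendsto_const_nhds
      ENNReal.tendsto_inv_nat_nhds_zero (fun _ => zero_le) h3⟩

/-- The approximating test functions may be chosen to converge almost everywhere. -/
theorem exists_seq_ae (h : SobolevZero Ω v G) :
    ∃ φ : ℕ → EuclideanSpace ℝ (Fin n) → ℝ, (∀ k, IsTestFunction Ω (φ k)) ∧
      Tendsto (fun k => eLpNorm (fun x => φ k x - v x) 1 (volume.restrict Ω)) atTop (𝓝 0) ∧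
      Tendsto (fun k => eLpNorm (fun x => ∇ (φ k) x - G x) 1 (volume.restrict Ω)) atTop (𝓝 0) ∧
      ∀ᵐ x ∂(volume.restrict Ω), Tendsto (fun k => φ k x) atTop (𝓝 (v x)) := by
  obtain ⟨φ, h1, h2, h3⟩ := h.exists_seq
  obtain ⟨ns, hns, hae⟩ := (tendstoInMeasure_of_tendsto_eLpNorm one_ne_zero
    (fun k => (h1 k).integrable.integrableOn.aestronglyMeasurable)
    h.integrableOn.aestronglyMeasurable h2).exists_seq_tendsto_ae
  exact ⟨fun k => φ (ns k), fun k => h1 _, h2.comp hns.tendsto_atTop,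
    h3.comp hns.tendsto_atTop, hae⟩

/-- Integration by parts holds for the approximating test functions and passes to the L¹ limit,
since ψ and ∇ψ are bounded. -/
theorem hasWeakGradient (h : SobolevZero Ω v G) : HasWeakGradient Ω v G := by
  refine ⟨h.integrableOn.locallyIntegrableOn, h.integrableOn_grad.locallyIntegrableOn,
    fun ψ hψ => ?_⟩
  obtain ⟨φ, h1, h2, h3⟩ := h.exists_seq
  obtain ⟨C, hC⟩ := hψ.hasCompactSupport_gradient.exists_bound_of_continuous hψ.continuous_gradient
  obtain ⟨D, hD⟩ := hψ.compactSupport.exists_bound_of_continuous hψ.smooth.continuous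
  have t1 : Tendsto (fun k => ∫ x in Ω, φ k x • ∇ ψ x) atTop (𝓝 (∫ x in Ω, v x • ∇ ψ x)) := by
    refine tendsto_integral_of_L1 _ (hψ.integrableOn_smul_gradient h.integrableOn.locallyIntegrableOn).aestronglyMeasurable
      (Eventually.of_forall fun k => hψ.integrableOn_smul_gradient
        (h1 k).integrable.integrableOn.locallyIntegrableOn) ?_
    have t0 := ENNReal.Tendsto.const_mul (a := ENNReal.ofReal C) h2 (Or.inr (by simp))
    rw [mul_zero] at t0
    refine tendsto_of_tendsto_of_tendsto_of_le_of_le tendsto_const_nhds t0 (fun _ => zero_le)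
      fun k => ?_
    simp only [eLpNorm_one_eq_lintegral_enorm]
    rw [← lintegral_const_mul' _ _ (by simp)]
    refine lintegral_mono fun x => ?_
    rw [← sub_smul, enorm_smul, mul_comm]
    gcongr
    rw [← ofReal_norm]
    exact ENNReal.ofReal_le_ofReal (hC x)
  have t2 : Tendsto (fun k => ∫ x in Ω, ψ x • ∇ (φ k) x) atTop (𝓝 (∫ x in Ω, ψ x • G x)) := by
    refine tendsto_integral_of_L1 _ (hψ.integrableOn_smul h.integrableOn_grad.locallyIntegrableOn).aestronglyMeasurable
      (Eventually.of_forall fun k => hψ.integrableOn_smul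
        (h1 k).integrable_gradient.integrableOn.locallyIntegrableOn) ?_
    have t0 := ENNReal.Tendsto.const_mul (a := ENNReal.ofReal D) h3 (Or.inr (by simp))
    rw [mul_zero] at t0
    refine tendsto_of_tendsto_of_tendsto_of_le_of_le tendsto_const_nhds t0 (fun _ => zero_le)
      fun k => ?_
    simp only [eLpNorm_one_eq_lintegral_enorm]
    rw [← lintegral_const_mul' _ _ (by simp)]
    refine lintegral_mono fun x => ?_
    rw [← smul_sub, enorm_smul]
    gcongr
    rw [← ofReal_norm]
    exact ENNReal.ofReal_le_ofReal (hD x)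
  refine tendsto_nhds_unique t1 (t2.neg.congr fun k => ?_)
  rw [(h1 k).integral_smul_gradient hψ]

theorem congr_grad (h : SobolevZero Ω v G) (hGH : G =ᵐ[volume.restrict Ω] H) :
    SobolevZero Ω v H := by
  refine ⟨h.integrableOn, h.integrableOn_grad.congr_fun_ae hGH, fun ε hε => ?_⟩
  obtain ⟨φ, h1, h2, h3⟩ := h.approx ε hε
  refine ⟨φ, h1, h2, ?_⟩
  rwa [← eLpNorm_congr_ae (f := fun x => ∇ φ x - G x)]
  filter_upwards [hGH] with x hx
  rw [hx]

theorem memW011 (hΩ : IsOpen Ω) (h : SobolevZero Ω v G) : MemW011 Ω v :=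
  ⟨⟨h.integrableOn, G, h.hasWeakGradient, h.integrableOn_grad⟩,
    (h.congr_grad (h.hasWeakGradient.weakGradient_ae_eq hΩ).symm).exists_seq⟩

theorem of_memW011 (hΩ : IsOpen Ω) (h : MemW011 Ω v) : SobolevZero Ω v (weakGradient Ω v) := by
  obtain ⟨⟨hv, G, hG, hGi⟩, φ, h1, h2, h3⟩ := h
  exact of_tendsto hv (hGi.congr_fun_ae (hG.weakGradient_ae_eq hΩ).symm)
    (fun k => of_isTestFunction (h1 k)) h2 h3

theorem sub (hv : SobolevZero Ω v G) (hw : SobolevZero Ω w H) :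
    SobolevZero Ω (fun x => v x - w x) (fun x => G x - H x) := by
  obtain ⟨φ, h1, h2, h3⟩ := hv.exists_seq
  obtain ⟨ψ, k1, k2, k3⟩ := hw.exists_seq
  refine of_tendsto (hv.integrableOn.sub hw.integrableOn)
    (hv.integrableOn_grad.sub hw.integrableOn_grad)
    (fun k => of_isTestFunction ((h1 k).sub (k1 k))) ?_ ?_
  · refine tendsto_of_tendsto_of_tendsto_of_le_of_le tendsto_const_nhds
      (by simpa using h2.add k2) (fun _ => zero_le) fun k => ?_
    have : (fun x => φ k x - ψ k x - (v x - w x)) =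
        (fun x => φ k x - v x) - fun x => ψ k x - w x := by
      ext x; simp only [Pi.sub_apply]; abel
    simp only [this]
    exact eLpNorm_sub_le
      ((h1 k).integrable.integrableOn.sub hv.integrableOn).aestronglyMeasurable
      ((k1 k).integrable.integrableOn.sub hw.integrableOn).aestronglyMeasurable le_rfl
  · refine tendsto_of_tendsto_of_tendsto_of_le_of_le tendsto_const_nhds
      (by simpa using h3.add k3) (fun _ => zero_le) fun k => ?_
    have : (fun x => ∇ (fun x => φ k x - ψ k x) x - (G x - H x)) =
        (fun x => ∇ (φ k) x - G x) - fun x => ∇ (ψ k) x - H x := by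
      ext1 x; simp only [Pi.sub_apply, (h1 k).gradient_sub (k1 k)]; abel
    simp only [this]
    exact eLpNorm_sub_le
      ((h1 k).integrable_gradient.integrableOn.sub hv.integrableOn_grad).aestronglyMeasurable
      ((k1 k).integrable_gradient.integrableOn.sub hw.integrableOn_grad).aestronglyMeasurable le_rfl

end SobolevZero

theorem HasWeakGradient.add {v w : EuclideanSpace ℝ (Fin n) → ℝ}
    {G H : EuclideanSpace ℝ (Fin n) → EuclideanSpace ℝ (Fin n)}
    (hv : HasWeakGradient Ω v G) (hw : HasWeakGradient Ω w H) :
    HasWeakGradient Ω (fun x => v x + w x) (fun x => G x + H x) where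
  locallyIntegrableOn := hv.locallyIntegrableOn.add hw.locallyIntegrableOn
  grad_locallyIntegrableOn := hv.grad_locallyIntegrableOn.add hw.grad_locallyIntegrableOn
  integral_eq φ hφ := by
    simp only [add_smul, smul_add]
    rw [integral_add (hφ.integrableOn_smul_gradient hv.locallyIntegrableOn)
        (hφ.integrableOn_smul_gradient hw.locallyIntegrableOn),
      integral_add (hφ.integrableOn_smul hv.grad_locallyIntegrableOn)
        (hφ.integrableOn_smul hw.grad_locallyIntegrableOn), hv.integral_eq φ hφ,
      hw.integral_eq φ hφ, neg_add]

/-! ### Chain rule, truncation and Sobolev inequality in W_0^{1,1}(Ω) -/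

theorem tendsto_eLpNorm_one_sub_of_dominated {α E : Type*} [MeasurableSpace α] {μ : Measure α}
    [NormedAddCommGroup E] {F : ℕ → α → E} {f : α → E} {bound : α → ℝ}
    (hF : ∀ i, AEStronglyMeasurable (F i) μ) (hb : Integrable bound μ)
    (h_bound : ∀ i, ∀ᵐ x ∂μ, ‖F i x‖ ≤ bound x)
    (h_lim : ∀ᵐ x ∂μ, Tendsto (fun i => F i x) atTop (𝓝 (f x))) :
    Tendsto (fun i => eLpNorm (fun x => F i x - f x) 1 μ) atTop (𝓝 0) := by
  simpa [eLpNorm_one_eq_lintegral_enorm, ofReal_norm] using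
    tendsto_lintegral_norm_of_dominated_convergence hF hb.hasFiniteIntegral h_bound h_lim

namespace SobolevZero

variable {v : EuclideanSpace ℝ (Fin n) → ℝ}
  {G : EuclideanSpace ℝ (Fin n) → EuclideanSpace ℝ (Fin n)}

/-- The chain rule for a smooth contraction vanishing at the origin. -/
theorem comp_left (h : SobolevZero Ω v G) {η : ℝ → ℝ} (hη : ContDiff ℝ ∞ η) (h0 : η 0 = 0)
    (h1 : ∀ t, ‖deriv η t‖ ≤ 1) :
    SobolevZero Ω (fun x => η (v x)) (fun x => deriv η (v x) • G x) := by
  obtain ⟨φ, hφ, t1, t2, t3⟩ := h.exists_seq_ae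
  have hd : Differentiable ℝ η := hη.differentiable (by simp)
  have hcd : Continuous (deriv η) := hη.continuous_deriv (by simp)
  have hL : ∀ s t, ‖η s - η t‖ ≤ ‖s - t‖ := fun s t => by
    simpa using Convex.norm_image_sub_le_of_norm_deriv_le (s := Set.univ) (C := 1)
      (fun x _ => hd x) (fun x _ => h1 x) convex_univ (Set.mem_univ t) (Set.mem_univ s)
  have hvm := h.integrableOn.aestronglyMeasurable
  have hGm := h.integrableOn_grad.aestronglyMeasurable
  have hmm : AEStronglyMeasurable (fun x => deriv η (v x)) (volume.restrict Ω) :=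
    hcd.comp_aestronglyMeasurable hvm
  have hφm : ∀ k, AEStronglyMeasurable (fun x => deriv η (φ k x)) (volume.restrict Ω) := fun k =>
    hcd.comp_aestronglyMeasurable (hφ k).integrable.integrableOn.aestronglyMeasurable
  have hle : ∀ (t : ℝ) (z : EuclideanSpace ℝ (Fin n)), ‖deriv η t • z‖ ≤ ‖z‖ := fun t z => by
    rw [norm_smul]
    exact mul_le_of_le_one_left (norm_nonneg _) (h1 t)
  refine of_tendsto (Integrable.mono h.integrableOn (hd.continuous.comp_aestronglyMeasurable hvm)
    (Eventually.of_forall fun x => by simpa [h0] using hL (v x) 0))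
    (Integrable.mono h.integrableOn_grad (hmm.smul hGm) (Eventually.of_forall fun x => hle _ _))
    (fun k => of_isTestFunction ((hφ k).comp_left hη h0)) ?_ ?_
  · refine tendsto_of_tendsto_of_tendsto_of_le_of_le tendsto_const_nhds t1 (fun _ => zero_le)
      fun k => eLpNorm_mono fun x => hL _ _
  -- The error splits in two: η'(φ_k)(∇φ_k - G) is small since |η'| ≤ 1, and (η'(φ_k) - η'(v))G by
  -- dominated convergence along φ_k → v a.e.
  · have t4 : Tendsto (fun k => eLpNorm (fun x => deriv η (φ k x) • G x - deriv η (v x) • G x) 1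
        (volume.restrict Ω)) atTop (𝓝 0) := by
      refine tendsto_eLpNorm_one_sub_of_dominated (fun k => (hφm k).smul hGm)
        h.integrableOn_grad.norm (fun k => Eventually.of_forall fun x => hle _ _) ?_
      filter_upwards [t3] with x hx
      exact ((hcd.tendsto _).comp hx).smul_const _
    refine tendsto_of_tendsto_of_tendsto_of_le_of_le tendsto_const_nhds
      (by simpa using t2.add t4) (fun _ => zero_le) fun k => ?_
    have e : (fun x => ∇ (fun x => η (φ k x)) x - deriv η (v x) • G x) =
        (fun x => deriv η (φ k x) • (∇ (φ k) x - G x)) +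
          fun x => deriv η (φ k x) • G x - deriv η (v x) • G x := by
      ext1 x
      simp only [Pi.add_apply, (hφ k).gradient_comp_left hd, smul_sub]
      abel
    simp only [e]
    have hsm := ((hφ k).integrable_gradient.integrableOn (s := Ω)).sub h.integrableOn_grad
    refine (eLpNorm_add_le ((hφm k).smul hsm.aestronglyMeasurable)
      (((hφm k).smul hGm).sub (hmm.smul hGm)) le_rfl).trans ?_
    refine add_le_add (eLpNorm_mono fun x => hle _ _) le_rfl

end SobolevZero

/-- The truncation of `t` at the levels `±k`. -/
def truncation (k t : ℝ) : ℝ := max (-k) (min k t)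

/-- The approximants are primitives of bump functions equal to 1 on [-k, k] and supported in
intervals shrinking to it. Their derivatives converge at every point, including t = ±k, so the
truncation's gradient is found without knowing that Dv = 0 a.e. on level sets. -/
theorem exists_smooth_approx_truncation {k : ℝ} (hk : 0 < k) :
    ∃ η : ℕ → ℝ → ℝ, (∀ i, ContDiff ℝ ∞ (η i)) ∧ (∀ i, η i 0 = 0) ∧
      (∀ i t, ‖deriv (η i) t‖ ≤ 1) ∧
      (∀ t, Tendsto (fun i => η i t) atTop (𝓝 (truncation k t))) ∧
      ∀ t, Tendsto (fun i => deriv (η i) t) atTop (𝓝 (if |t| ≤ k then 1 else 0)) := by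
  let χ : ℕ → ContDiffBump (0 : ℝ) := fun i =>
    ⟨k, k + 1 / ((i : ℝ) + 1), hk, lt_add_of_pos_right _ (by positivity)⟩
  have hc : ∀ i, Continuous (χ i) := fun i => (χ i).continuous
  have hlim : ∀ t, Tendsto (fun i => χ i t) atTop (𝓝 (if |t| ≤ k then 1 else 0)) := by
    intro t
    split_ifs with ht
    · refine tendsto_const_nhds.congr fun i => ((χ i).one_of_mem_closedBall ?_).symm
      simpa [χ] using ht
    · have h1 : ∀ᶠ i : ℕ in atTop, 1 / ((i : ℝ) + 1) < |t| - k :=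
        tendsto_one_div_add_atTop_nhds_zero_nat.eventually_lt_const (by linarith)
      refine tendsto_const_nhds.congr' ?_
      filter_upwards [h1] with i hi
      refine ((χ i).zero_of_le_dist ?_).symm
      simp only [χ, Real.dist_eq, sub_zero]
      linarith
  have hdη : ∀ i t, HasDerivAt (fun t => ∫ s in (0 : ℝ)..t, χ i s) (χ i t) t := fun i t =>
    intervalIntegral.integral_hasDerivAt_right ((hc i).intervalIntegrable _ _)
      ((hc i).stronglyMeasurableAtFilter _ _) (hc i).continuousAt
  have hder : ∀ i, deriv (fun t => ∫ s in (0 : ℝ)..t, χ i s) = χ i := fun i =>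
    funext fun t => (hdη i t).deriv
  have hin : ∀ i, ∀ t ∈ Set.Icc 0 k, ∫ s in (0 : ℝ)..t, χ i s = t := by
    intro i t ht
    have : ∫ s in (0 : ℝ)..t, χ i s = ∫ s in (0 : ℝ)..t, (1 : ℝ) := by
      refine intervalIntegral.integral_congr fun s hs => (χ i).one_of_mem_closedBall ?_
      rw [Set.uIcc_of_le ht.1] at hs
      simp only [χ, Metric.mem_closedBall, Real.dist_eq, sub_zero]
      rw [abs_of_nonneg hs.1]
      exact hs.2.trans ht.2
    simpa using this
  have hpos : ∀ t, 0 ≤ t →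
      Tendsto (fun i => ∫ s in (0 : ℝ)..t, χ i s) atTop (𝓝 (truncation k t)) := by
    intro t ht
    rcases le_or_gt t k with htk | htk
    · have : truncation k t = t := by
        rw [truncation, min_eq_right htk, max_eq_right (by linarith)]
      rw [this]
      exact tendsto_const_nhds.congr fun i => (hin i t ⟨ht, htk⟩).symm
    · have : truncation k t = k := by
        rw [truncation, min_eq_left htk.le, max_eq_right (by linarith)]
      rw [this]
      have h2 : Tendsto (fun i => ∫ s in k..t, χ i s) atTop (𝓝 (∫ s in k..t, (0 : ℝ))) := by
        refine intervalIntegral.tendsto_integral_filter_of_dominated_convergence (fun _ => 1)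
          (Eventually.of_forall fun i => (hc i).aestronglyMeasurable)
          (Eventually.of_forall fun i => Eventually.of_forall fun s _ => ?_)
          intervalIntegrable_const (Eventually.of_forall fun s hs => ?_)
        · rw [Real.norm_of_nonneg (χ i).nonneg]; exact (χ i).le_one
        · rw [Set.uIoc_of_le htk.le] at hs
          have := hlim s
          rwa [if_neg (by rw [abs_of_pos (hk.trans hs.1)]; exact not_le.2 hs.1)] at this
      have h3 := h2.const_add k
      simp only [intervalIntegral.integral_zero, add_zero] at h3
      refine h3.congr fun i => ?_
      nth_rw 1 [← hin i k ⟨hk.le, le_rfl⟩]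
      exact intervalIntegral.integral_add_adjacent_intervals ((hc i).intervalIntegrable _ _)
        ((hc i).intervalIntegrable _ _)
  refine ⟨fun i t => ∫ s in (0 : ℝ)..t, χ i s, fun i => ?_, fun i => by simp, fun i t => ?_,
    fun t => ?_, fun t => ?_⟩
  · rw [contDiff_infty_iff_deriv, hder]
    exact ⟨fun t => (hdη i t).differentiableAt, (χ i).contDiff⟩
  · rw [hder, Real.norm_of_nonneg (χ i).nonneg]
    exact (χ i).le_one
  · rcases le_total 0 t with ht | ht
    · exact hpos t ht
    -- The bump is even, so its primitive is odd, as is the truncation.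
    · have h1 := (hpos (-t) (by linarith)).neg
      have h2 : - truncation k (-t) = truncation k t := by
        simp only [truncation]
        rw [← min_neg_neg, ← max_neg_neg, neg_neg, neg_neg, min_comm, max_comm]
        rw [max_min_distrib_left, max_eq_right (by linarith : -k ≤ k), min_comm, max_comm t]
      rw [h2] at h1
      refine h1.congr fun i => ?_
      have h3 := intervalIntegral.integral_comp_neg (f := fun s => χ i s) (a := 0) (b := t)
      simp only [(χ i).neg, neg_zero] at h3
      change _ = ∫ s in (0 : ℝ)..t, χ i s
      rw [h3, ← intervalIntegral.integral_symm]
  · simpa only [hder] using hlim t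

theorem abs_truncation_le {k : ℝ} (hk : 0 < k) (t : ℝ) : |truncation k t| ≤ |t| := by
  unfold truncation
  rcases le_total 0 t with h | h
  · rw [abs_of_nonneg h, abs_le]
    constructor
    · exact le_max_of_le_right (le_min (by linarith) (by linarith))
    · exact max_le (by linarith) (min_le_right _ _)
  · rw [abs_of_nonpos h, abs_le]
    constructor
    · exact le_max_of_le_right (le_min (by linarith) (by linarith))
    · exact max_le (by linarith) ((min_le_right _ _).trans (by linarith))

theorem sub_le_abs_sub_truncation {k : ℝ} (hk : 0 ≤ k) (t : ℝ) :
    |t| - k ≤ |t - truncation k t| := by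
  have h1 : |truncation k t| ≤ k :=
    abs_le.2 ⟨le_max_left _ _, max_le (by linarith) (min_le_left _ _)⟩
  linarith [abs_sub_abs_le_abs_sub t (truncation k t)]

theorem continuous_truncation (k : ℝ) : Continuous (truncation k) := by
  unfold truncation; fun_prop

namespace SobolevZero

variable {v : EuclideanSpace ℝ (Fin n) → ℝ}
  {G : EuclideanSpace ℝ (Fin n) → EuclideanSpace ℝ (Fin n)}

/-- Apply the smooth chain rule to the approximants η_i and let i → ∞; |v| and |G| dominate. -/
theorem truncation (h : SobolevZero Ω v G) {k : ℝ} (hk : 0 < k) :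
    SobolevZero Ω (fun x => truncation k (v x))
      (fun x => (if |v x| ≤ k then (1 : ℝ) else 0) • G x) := by
  obtain ⟨η, h1, h2, h3, h4, h5⟩ := exists_smooth_approx_truncation hk
  have hvm := h.integrableOn.aestronglyMeasurable
  have hGm := h.integrableOn_grad.aestronglyMeasurable
  have hS : ∀ i, SobolevZero Ω (fun x => η i (v x)) (fun x => deriv (η i) (v x) • G x) :=
    fun i => h.comp_left (h1 i) (h2 i) (h3 i)
  have hL : ∀ i t, ‖η i t‖ ≤ ‖t‖ := fun i t => by
    simpa [h2] using Convex.norm_image_sub_le_of_norm_deriv_le (s := Set.univ) (C := 1)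
      (fun x _ => (h1 i).differentiable (by simp) x) (fun x _ => h3 i x) convex_univ
      (Set.mem_univ 0) (Set.mem_univ t)
  have hlim : ∀ x, Tendsto (fun i => deriv (η i) (v x) • G x) atTop
      (𝓝 ((if |v x| ≤ k then (1 : ℝ) else 0) • G x)) := fun x => (h5 (v x)).smul_const _
  refine of_tendsto (Integrable.mono h.integrableOn
    ((continuous_truncation k).comp_aestronglyMeasurable hvm)
    (Eventually.of_forall fun x => abs_truncation_le hk _))
    (Integrable.mono h.integrableOn_grad (aestronglyMeasurable_of_tendsto_ae atTop
      (fun i => (hS i).integrableOn_grad.aestronglyMeasurable) (Eventually.of_forall hlim))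
      (Eventually.of_forall fun x => ?_)) hS
    (tendsto_eLpNorm_one_sub_of_dominated (fun i => (hS i).integrableOn.aestronglyMeasurable)
      h.integrableOn.norm (fun i => Eventually.of_forall fun x => hL i _)
      (Eventually.of_forall fun x => h4 _))
    (tendsto_eLpNorm_one_sub_of_dominated (fun i => (hS i).integrableOn_grad.aestronglyMeasurable)
      h.integrableOn_grad.norm (fun i => Eventually.of_forall fun x => ?_)
      (Eventually.of_forall hlim))
  · split_ifs <;> simp
  · rw [norm_smul]
    exact mul_le_of_le_one_left (norm_nonneg _) (h3 i _)

/-- The Sobolev inequality in `W_0^{1,1}(Ω)`. -/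
theorem eLpNorm_le (h : SobolevZero Ω v G) {q : NNReal}
    (hq : NNReal.HolderConjugate (n : NNReal) q) :
    eLpNorm v q (volume.restrict Ω) ≤
      eLpNormLESNormFDerivOneConst (volume : Measure (EuclideanSpace ℝ (Fin n))) q *
        eLpNorm G 1 (volume.restrict Ω) := by
  obtain ⟨φ, hφ, t1, t2, t3⟩ := h.exists_seq_ae
  have hq' : NNReal.HolderConjugate (Module.finrank ℝ (EuclideanSpace ℝ (Fin n)) : NNReal) q := by
    simpa using hq
  -- Fatou along a.e. convergent test functions; each satisfies the Gagliardo–Nirenberg–Sobolev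
  -- inequality on the whole space.
  refine (Lp.eLpNorm_lim_le_liminf_eLpNorm
    (fun k => (hφ k).integrable.integrableOn.aestronglyMeasurable) v t3).trans ?_
  set S := eLpNormLESNormFDerivOneConst (volume : Measure (EuclideanSpace ℝ (Fin n))) q
  have hb : ∀ k, eLpNorm (φ k) q (volume.restrict Ω) ≤
      S * (eLpNorm (fun x => ∇ (φ k) x - G x) 1 (volume.restrict Ω) +
        eLpNorm G 1 (volume.restrict Ω)) := by
    intro k
    refine (eLpNorm_restrict_le _ _ _ _).trans ((eLpNorm_le_eLpNorm_fderiv_one volume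
      ((hφ k).smooth.of_le (by simp)) (hφ k).compactSupport hq').trans ?_)
    gcongr
    have e1 : eLpNorm (fderiv ℝ (φ k)) 1 volume = eLpNorm (∇ (φ k)) 1 volume :=
      eLpNorm_congr_norm_ae (Eventually.of_forall fun x => (norm_gradient_eq_norm_fderiv _ _).symm)
    have e2 : eLpNorm (∇ (φ k)) 1 volume = eLpNorm (∇ (φ k)) 1 (volume.restrict Ω) := by
      refine (eLpNorm_restrict_eq_of_support_subset fun x hx => ?_).symm
      by_contra h'
      exact hx ((hφ k).gradient_eq_zero_of_notMem h')
    have e3 : ∇ (φ k) = (fun x => ∇ (φ k) x - G x) + G := by ext1 x; simp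
    rw [e1, e2]
    nth_rw 1 [e3]
    exact eLpNorm_add_le ((hφ k).integrable_gradient.integrableOn.sub
      h.integrableOn_grad).aestronglyMeasurable h.integrableOn_grad.aestronglyMeasurable le_rfl
  have ht : Tendsto (fun k => S * (eLpNorm (fun x => ∇ (φ k) x - G x) 1 (volume.restrict Ω) +
        eLpNorm G 1 (volume.restrict Ω))) atTop (𝓝 (S * eLpNorm G 1 (volume.restrict Ω))) := by
    have := ENNReal.Tendsto.const_mul (a := (S : ℝ≥0∞)) (t2.add_const
      (eLpNorm G 1 (volume.restrict Ω))) (Or.inr (by simp))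
    simpa using this
  rw [← ht.liminf_eq]
  exact liminf_le_liminf (Eventually.of_forall hb)

end SobolevZero

/-! ### The function t ln(e+t) and Hölder's inequality -/

/-- The function `t ln (e + t)`. -/
noncomputable def mulLog (t : ℝ) : ℝ := t * Real.log (Real.exp 1 + t)

theorem one_le_log_exp_one_add {t : ℝ} (ht : 0 ≤ t) : 1 ≤ Real.log (Real.exp 1 + t) := by
  rw [Real.le_log_iff_exp_le (by positivity)]
  linarith

theorem mulLog_nonneg {t : ℝ} (ht : 0 ≤ t) : 0 ≤ mulLog t :=
  mul_nonneg ht (zero_le_one.trans (one_le_log_exp_one_add ht))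

theorem measurable_mulLog : Measurable mulLog := by
  unfold mulLog; fun_prop

theorem mulLog_rpow {t p : ℝ} (ht : 0 ≤ t) :
    mulLog t ^ p = t ^ p * Real.log (Real.exp 1 + t) ^ p :=
  Real.mul_rpow ht (zero_le_one.trans (one_le_log_exp_one_add ht))

/-- Either t ≤ s, or ln(e+t) ≥ ln(e+s). This is where the logarithm in the growth condition becomes
a gain. -/
theorem le_add_inv_log_mul_mulLog {s t : ℝ} (hs : 0 ≤ s) (ht : 0 ≤ t) :
    t ≤ s + (Real.log (Real.exp 1 + s))⁻¹ * mulLog t := by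
  have h1 := one_le_log_exp_one_add hs
  rcases le_total t s with h | h
  · have := mulLog_nonneg ht
    have : 0 ≤ (Real.log (Real.exp 1 + s))⁻¹ * mulLog t := by positivity
    linarith
  · have h2 : Real.log (Real.exp 1 + s) ≤ Real.log (Real.exp 1 + t) :=
      Real.log_le_log (by positivity) (by linarith)
    have h3 : t ≤ (Real.log (Real.exp 1 + s))⁻¹ * mulLog t := by
      rw [inv_mul_eq_div, le_div_iff₀ (by linarith), mulLog]
      gcongr
    linarith

/-- Hölder twice, L^p into L¹ for g and L^σ into L¹ for F; the powers of the total mass add up as (1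
- 1/p) + (1 - 1/σ)/p = 1 - 1/(pσ). -/
theorem eLpNorm_one_le_of_lintegral_rpow_le {α : Type*} [MeasurableSpace α] {m : Measure α}
    {g F : α → ℝ} (hg : AEStronglyMeasurable g m) (hF : AEStronglyMeasurable F m)
    {p σ : ℝ} (hp : 1 < p) (hσ : 1 < σ) {c N : ℝ≥0∞}
    (hgF : ∫⁻ x, ‖g x‖ₑ ^ p ∂m ≤ c * ∫⁻ x, ‖F x‖ₑ ∂m)
    (hN : eLpNorm F (ENNReal.ofReal σ) m ≤ N) :
    eLpNorm g 1 m ≤ (c * N) ^ (1 / p) * m Set.univ ^ (1 - 1 / (p * σ)) := by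
  have hp0 : 0 < p := by linarith
  have hσ0 : 0 < σ := by linarith
  have h1 := eLpNorm_le_eLpNorm_mul_rpow_measure_univ (p := 1) (q := ENNReal.ofReal p)
    (by simpa using hp.le) hg
  have h2 := eLpNorm_le_eLpNorm_mul_rpow_measure_univ (p := 1) (q := ENNReal.ofReal σ)
    (by simpa using hσ.le) hF
  rw [ENNReal.toReal_ofReal hp0.le, ENNReal.toReal_one, div_one] at h1
  rw [ENNReal.toReal_ofReal hσ0.le, ENNReal.toReal_one, div_one, eLpNorm_one_eq_lintegral_enorm]
    at h2
  rw [eLpNorm_eq_lintegral_rpow_enorm_toReal (p := ENNReal.ofReal p) (by simpa using hp0)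
    (by simp), ENNReal.toReal_ofReal hp0.le] at h1
  refine h1.trans ?_
  have h3 : (∫⁻ x, ‖g x‖ₑ ^ p ∂m) ^ (1 / p) ≤
      ((c * N) * m Set.univ ^ (1 - 1 / σ)) ^ (1 / p) := by
    gcongr
    refine hgF.trans ?_
    rw [mul_assoc]
    gcongr
    exact h2.trans (by gcongr)
  refine (mul_le_mul_left h3 _).trans ?_
  rw [ENNReal.mul_rpow_of_nonneg _ _ (by positivity), mul_assoc, ← ENNReal.rpow_mul,
    ← ENNReal.rpow_add_of_nonneg]
  · apply le_of_eq
    congr 2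
    field_simp
    ring
  · exact mul_nonneg (by rw [sub_nonneg, div_le_one hσ0]; exact hσ.le) (by positivity)
  · rw [sub_nonneg, div_le_one hp0]; exact hp.le

/-! ### Energy comparison and the level-set estimate -/

theorem MemW11.hasWeakGradient_weakGradient {u : EuclideanSpace ℝ (Fin n) → ℝ}
    (h : MemW11 Ω u) : HasWeakGradient Ω u (weakGradient Ω u) := by
  obtain ⟨_, G, hG, _⟩ := h
  have hex : ∃ G, HasWeakGradient Ω u G := ⟨G, hG⟩
  unfold weakGradient
  rw [dif_pos hex]
  exact hex.choose_spec

theorem weakGradient_add_ae_eq (hΩ : IsOpen Ω) {ustar v : EuclideanSpace ℝ (Fin n) → ℝ}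
    {G : EuclideanSpace ℝ (Fin n) → EuclideanSpace ℝ (Fin n)}
    (hs : MemW11 Ω ustar) (hv : SobolevZero Ω v G) :
    weakGradient Ω (fun x => ustar x + v x) =ᵐ[volume.restrict Ω]
      fun x => weakGradient Ω ustar x + G x :=
  (hs.hasWeakGradient_weakGradient.add hv.hasWeakGradient).weakGradient_ae_eq hΩ

section Minimizer

variable {f : EuclideanSpace ℝ (Fin n) → EuclideanSpace ℝ (Fin n) → ℝ}
  {ustar u : EuclideanSpace ℝ (Fin n) → ℝ}

theorem IsMinimizer.sobolevZero (hΩ : IsOpen Ω) (hmin : IsMinimizer Ω f ustar u) :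
    SobolevZero Ω (fun x => u x - ustar x) (weakGradient Ω fun x => u x - ustar x) :=
  SobolevZero.of_memW011 hΩ hmin.1.1

theorem IsMinimizer.nullMeasurableSet (hΩ : IsOpen Ω) (hmin : IsMinimizer Ω f ustar u) (k : ℝ) :
    NullMeasurableSet {x | k < |u x - ustar x|} (volume.restrict Ω) :=
  nullMeasurableSet_lt aemeasurable_const
    (hmin.sobolevZero hΩ).integrableOn.aestronglyMeasurable.aemeasurable.abs

theorem IsMinimizer.weakGradient_ae_eq (hΩ : IsOpen Ω) (hmin : IsMinimizer Ω f ustar u)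
    (hs : MemW11 Ω ustar) :
    weakGradient Ω u =ᵐ[volume.restrict Ω]
      fun x => weakGradient Ω ustar x + weakGradient Ω (fun x => u x - ustar x) x := by
  have := weakGradient_add_ae_eq hΩ hs (hmin.sobolevZero hΩ)
  simpa only [add_sub_cancel] using this

/-- Compare u with u_* + T_k(u - u_*): the integrands agree a.e. off the superlevel set, and on it
the competitor has gradient Du_*. -/
theorem IsMinimizer.setIntegral_le (hΩ : IsOpen Ω) (hmin : IsMinimizer Ω f ustar u)
    (hs : MemW11 Ω ustar) (hfs : IntegrableOn (fun x => f x (weakGradient Ω ustar x)) Ω)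
    {k : ℝ} (hk : 0 < k) :
    ∫ x in {x | k < |u x - ustar x|}, f x (weakGradient Ω u x) ∂(volume.restrict Ω) ≤
      ∫ x in {x | k < |u x - ustar x|}, f x (weakGradient Ω ustar x) ∂(volume.restrict Ω) := by
  set v : EuclideanSpace ℝ (Fin n) → ℝ := fun x => u x - ustar x with hv
  set A : Set (EuclideanSpace ℝ (Fin n)) := {x | k < |u x - ustar x|} with hA
  have hAm : NullMeasurableSet A (volume.restrict Ω) := hmin.nullMeasurableSet hΩ k
  have hT := (hmin.sobolevZero hΩ).truncation hk
  set w : EuclideanSpace ℝ (Fin n) → ℝ := fun x => ustar x + truncation k (v x) with hw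
  have hfu := hmin.1.2
  have e1 : (fun x => f x (weakGradient Ω w x)) =ᵐ[volume.restrict Ω]
      (fun x => f x (weakGradient Ω u x)) + A.indicator
        ((fun x => f x (weakGradient Ω ustar x)) - fun x => f x (weakGradient Ω u x)) := by
    filter_upwards [weakGradient_add_ae_eq hΩ hs hT, hmin.weakGradient_ae_eq hΩ hs] with x h1 h2
    rw [hw, h1]
    by_cases hx : x ∈ A
    · have hx' : ¬ |u x - ustar x| ≤ k := not_le.2 hx
      simp [hx, hx']
    · have hx' : |u x - ustar x| ≤ k := not_lt.1 hx
      simp [hx, hx', h2]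
  have hind : Integrable (A.indicator ((fun x => f x (weakGradient Ω ustar x)) -
      fun x => f x (weakGradient Ω u x))) (volume.restrict Ω) :=
    (Integrable.sub hfs hfu).indicator₀ hAm
  have hwc : w ∈ competitors Ω f ustar := by
    refine ⟨?_, (Integrable.add hfu hind).congr e1.symm⟩
    have : (fun x => w x - ustar x) = fun x => truncation k (v x) := by
      ext x; simp [hw]
    rw [this]
    exact hT.memW011 hΩ
  have h1 := hmin.2 w hwc
  unfold variationalIntegral at h1
  rw [integral_congr_ae e1, integral_add' hfu hind, integral_indicator₀ hAm,
    integral_sub' hfs.integrable.restrict (Integrable.restrict hfu)] at h1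
  linarith

variable {p ν σ : ℝ} {a : EuclideanSpace ℝ (Fin n) → ℝ}

theorem IsMinimizer.lintegral_mulLog_le (hΩ : IsOpen Ω) (hmin : IsMinimizer Ω f ustar u)
    (hs : MemW11 Ω ustar) (hfs : IntegrableOn (fun x => f x (weakGradient Ω ustar x)) Ω)
    (ha : IntegrableOn a Ω) (hν : 0 < ν) (hp : 0 < p)
    (hf : ∀ᵐ x ∂(volume.restrict Ω), ∀ z : EuclideanSpace ℝ (Fin n),
        ν * ‖z‖ ^ p * Real.log (Real.exp 1 + ‖z‖) ^ p - a x ≤ f x z)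
    {k : ℝ} (hk : 0 < k) :
    ∫⁻ x in {x | k < |u x - ustar x|}, ‖mulLog ‖weakGradient Ω u x‖‖ₑ ^ p ∂(volume.restrict Ω) ≤
      ENNReal.ofReal (1 / ν) * ∫⁻ x in {x | k < |u x - ustar x|},
        ‖f x (weakGradient Ω ustar x) + a x‖ₑ ∂(volume.restrict Ω) := by
  set A : Set (EuclideanSpace ℝ (Fin n)) := {x | k < |u x - ustar x|} with hA
  set m := (volume.restrict Ω).restrict A with hm
  have hfu : Integrable (fun x => f x (weakGradient Ω u x)) m := Integrable.restrict hmin.1.2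
  have ham : Integrable a m := Integrable.restrict ha
  have hfsm : Integrable (fun x => f x (weakGradient Ω ustar x)) m := Integrable.restrict hfs
  have hpt : ∀ᵐ x ∂m, mulLog ‖weakGradient Ω u x‖ ^ p ≤
      1 / ν * (f x (weakGradient Ω u x) + a x) := by
    filter_upwards [ae_restrict_of_ae hf] with x hx
    rw [one_div_mul_eq_div, le_div_iff₀ hν, mulLog_rpow (norm_nonneg _)]
    linarith [hx (weakGradient Ω u x)]
  calc ∫⁻ x, ‖mulLog ‖weakGradient Ω u x‖‖ₑ ^ p ∂m
      ≤ ∫⁻ x, ENNReal.ofReal (1 / ν * (f x (weakGradient Ω u x) + a x)) ∂m := by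
        refine lintegral_mono_ae ?_
        filter_upwards [hpt] with x hx
        have h0 := mulLog_nonneg (norm_nonneg (weakGradient Ω u x))
        rw [Real.enorm_of_nonneg h0, ENNReal.ofReal_rpow_of_nonneg h0 hp.le]
        exact ENNReal.ofReal_le_ofReal hx
    _ = ENNReal.ofReal (∫ x, 1 / ν * (f x (weakGradient Ω u x) + a x) ∂m) := by
        refine (ofReal_integral_eq_lintegral_ofReal ((hfu.add ham).const_mul _) ?_).symm
        filter_upwards [hpt] with x hx
        exact (Real.rpow_nonneg (mulLog_nonneg (norm_nonneg _)) _).trans hx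
    _ ≤ ENNReal.ofReal (1 / ν * ∫ x, f x (weakGradient Ω ustar x) + a x ∂m) := by
        apply ENNReal.ofReal_le_ofReal
        rw [integral_const_mul, integral_add hfu ham, integral_add hfsm ham]
        have := hmin.setIntegral_le hΩ hs hfs hk
        gcongr
    _ ≤ _ := by
        rw [ENNReal.ofReal_mul (by positivity)]
        gcongr
        exact (Real.ofReal_le_enorm _).trans (enorm_integral_le_lintegral_enorm _)

/-- Coercivity alone suffices here. The bound is applied with G = Du_*, the other half of D(u - u_*)
= Du - Du_*. -/
theorem lintegral_mulLog_star_le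
    (hν : 0 < ν) (hp : 0 < p)
    (hf : ∀ᵐ x ∂(volume.restrict Ω), ∀ z : EuclideanSpace ℝ (Fin n),
        ν * ‖z‖ ^ p * Real.log (Real.exp 1 + ‖z‖) ^ p - a x ≤ f x z)
    (G : EuclideanSpace ℝ (Fin n) → EuclideanSpace ℝ (Fin n))
    (A : Set (EuclideanSpace ℝ (Fin n))) :
    ∫⁻ x in A, ‖mulLog ‖G x‖‖ₑ ^ p ∂(volume.restrict Ω) ≤
      ENNReal.ofReal (1 / ν) * ∫⁻ x in A, ‖f x (G x) + a x‖ₑ ∂(volume.restrict Ω) := by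
  rw [← lintegral_const_mul' _ _ (by simp)]
  refine lintegral_mono_ae ?_
  filter_upwards [ae_restrict_of_ae hf] with x hx
  have h0 := mulLog_nonneg (norm_nonneg (G x))
  have h1 : mulLog ‖G x‖ ^ p ≤ 1 / ν * (f x (G x) + a x) := by
    rw [one_div_mul_eq_div, le_div_iff₀ hν, mulLog_rpow (norm_nonneg _)]
    linarith [hx (G x)]
  rw [Real.enorm_of_nonneg h0, ENNReal.ofReal_rpow_of_nonneg h0 hp.le]
  refine (ENNReal.ofReal_le_ofReal h1).trans ?_
  rw [ENNReal.ofReal_mul (by positivity)]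
  gcongr
  exact Real.ofReal_le_enorm _

theorem lintegral_enorm_le_add_mulLog {α E : Type*} [MeasurableSpace α] {m : Measure α}
    [NormedAddCommGroup E] (G : α → E) {s : ℝ} (hs : 0 ≤ s) :
    ∫⁻ x, ‖G x‖ₑ ∂m ≤ ENNReal.ofReal s * m Set.univ +
      ENNReal.ofReal (Real.log (Real.exp 1 + s))⁻¹ * eLpNorm (fun x => mulLog ‖G x‖) 1 m := by
  rw [eLpNorm_one_eq_lintegral_enorm, ← lintegral_const_mul' _ _ (by simp), ← lintegral_const,
    ← lintegral_add_left measurable_const]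
  refine lintegral_mono fun x => ?_
  have h0 := mulLog_nonneg (norm_nonneg (G x))
  have h1 := one_le_log_exp_one_add hs
  rw [← ofReal_norm, Real.enorm_of_nonneg h0, ← ENNReal.ofReal_mul (by positivity),
    ← ENNReal.ofReal_add hs (by positivity)]
  exact ENNReal.ofReal_le_ofReal (le_add_inv_log_mul_mulLog hs (norm_nonneg _))

/-- Sobolev's inequality for v - T_k(v), v = u - u_*: it is at least h - k in modulus on {|v| > h},
and its gradient lives on {|v| > k}. The factor 2 counts Du and Du_*. -/
theorem IsMinimizer.level_estimate_enn (hΩ : IsOpen Ω) (hb : Bornology.IsBounded Ω)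
    (hmin : IsMinimizer Ω f ustar u) (hs : MemW11 Ω ustar) (hν : 0 < ν) (hp : 1 < p) (hσ : 1 < σ)
    (hf : ∀ᵐ x ∂(volume.restrict Ω), ∀ z : EuclideanSpace ℝ (Fin n),
        ν * ‖z‖ ^ p * Real.log (Real.exp 1 + ‖z‖) ^ p - a x ≤ f x z)
    (ha : MemLp a (ENNReal.ofReal σ) (volume.restrict Ω))
    (hfs : MemLp (fun x => f x (weakGradient Ω ustar x)) (ENNReal.ofReal σ) (volume.restrict Ω))
    {q : NNReal} (hq : NNReal.HolderConjugate (n : NNReal) q)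
    {s k h : ℝ} (hs0 : 0 ≤ s) (hk : 0 < k) :
    ENNReal.ofReal (h - k) * (volume.restrict Ω) {x | h < |u x - ustar x|} ^ (1 / (q : ℝ)) ≤
      eLpNormLESNormFDerivOneConst (volume : Measure (EuclideanSpace ℝ (Fin n))) q *
      (2 * (ENNReal.ofReal s * (volume.restrict Ω) {x | k < |u x - ustar x|} +
        ENNReal.ofReal (Real.log (Real.exp 1 + s))⁻¹ *
          ((ENNReal.ofReal (1 / ν) * eLpNorm (fun x => f x (weakGradient Ω ustar x) + a x)
            (ENNReal.ofReal σ) (volume.restrict Ω)) ^ (1 / p) *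
          (volume.restrict Ω) {x | k < |u x - ustar x|} ^ (1 - 1 / (p * σ))))) := by
  have hp0 : 0 < p := by linarith
  have hfin : IsFiniteMeasure (volume.restrict Ω) :=
    isFiniteMeasure_restrict.2 hb.measure_lt_top.ne
  have hσ1 : 1 ≤ ENNReal.ofReal σ := by simpa using hσ.le
  have hfsi : IntegrableOn (fun x => f x (weakGradient Ω ustar x)) Ω := hfs.integrable hσ1
  have hai : IntegrableOn a Ω := ha.integrable hσ1
  have hS := hmin.sobolevZero hΩ
  have hT := hS.sub (hS.truncation hk)
  have hsob := hT.eLpNorm_le hq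
  have hq0 : (0 : ℝ) < q := hq.coe.symm.pos
  set S := eLpNormLESNormFDerivOneConst (volume : Measure (EuclideanSpace ℝ (Fin n))) q
  set A : Set (EuclideanSpace ℝ (Fin n)) := {x | k < |u x - ustar x|} with hA
  have hAm : NullMeasurableSet A (volume.restrict Ω) := hmin.nullMeasurableSet hΩ k
  have hcheb : ENNReal.ofReal (h - k) *
      (volume.restrict Ω) {x | h < |u x - ustar x|} ^ (1 / (q : ℝ)) ≤
      eLpNorm (fun x => (u x - ustar x) - truncation k (u x - ustar x)) q (volume.restrict Ω) := by
    have h1 := mul_meas_ge_le_pow_eLpNorm' (volume.restrict Ω) (p := (q : ℝ≥0∞))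
      (by simpa using hq0.ne') (by simp) hT.integrableOn.aestronglyMeasurable
      (ENNReal.ofReal (h - k))
    have h2 : (volume.restrict Ω) {x | h < |u x - ustar x|} ≤ (volume.restrict Ω)
        {x | ENNReal.ofReal (h - k) ≤
          ‖(u x - ustar x) - truncation k (u x - ustar x)‖ₑ} := by
      refine measure_mono fun x hx => ?_
      have h3 := sub_le_abs_sub_truncation hk.le (u x - ustar x)
      have hx' : h < |u x - ustar x| := hx
      change ENNReal.ofReal (h - k) ≤ _
      rw [← ofReal_norm]
      refine ENNReal.ofReal_le_ofReal ?_
      rw [Real.norm_eq_abs]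
      linarith
    rw [ENNReal.coe_toReal] at h1
    have h4 := ENNReal.rpow_le_rpow ((mul_le_mul_right h2 _).trans h1)
      (by positivity : 0 ≤ 1 / (q : ℝ))
    rwa [ENNReal.mul_rpow_of_nonneg _ _ (by positivity), ← ENNReal.rpow_mul, ← ENNReal.rpow_mul,
      mul_one_div_cancel hq0.ne', ENNReal.rpow_one, ENNReal.rpow_one] at h4
  refine hcheb.trans (hsob.trans ?_)
  gcongr
  set v : EuclideanSpace ℝ (Fin n) → ℝ := fun x => u x - ustar x with hv
  have hU := hmin.weakGradient_ae_eq hΩ hs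
  have hUs : AEStronglyMeasurable (weakGradient Ω ustar) (volume.restrict Ω) := by
    obtain ⟨_, G, hG, hGi⟩ := hs
    exact hGi.aestronglyMeasurable.congr (hG.weakGradient_ae_eq hΩ).symm
  have hUm : AEStronglyMeasurable (weakGradient Ω u) (volume.restrict Ω) :=
    (hUs.add hS.integrableOn_grad.aestronglyMeasurable).congr hU.symm
  have hgrad : eLpNorm (fun x => weakGradient Ω v x - (if |v x| ≤ k then (1 : ℝ) else 0) •
      weakGradient Ω v x) 1 (volume.restrict Ω) ≤
      ∫⁻ x in A, ‖weakGradient Ω u x‖ₑ ∂(volume.restrict Ω) +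
        ∫⁻ x in A, ‖weakGradient Ω ustar x‖ₑ ∂(volume.restrict Ω) := by
    rw [eLpNorm_one_eq_lintegral_enorm, ← lintegral_add_left' hUm.enorm.restrict,
      ← lintegral_indicator₀ hAm]
    refine lintegral_mono_ae ?_
    filter_upwards [hU] with x hx
    by_cases hxA : x ∈ A
    · have hx' : ¬ |v x| ≤ k := not_le.2 hxA
      have e : weakGradient Ω v x = weakGradient Ω u x - weakGradient Ω ustar x := by
        rw [hx, add_sub_cancel_left]
      simp only [hxA, hx', Set.indicator_of_mem, if_false, zero_smul, sub_zero]
      rw [e]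
      exact enorm_sub_le
    · have hx' : |v x| ≤ k := not_lt.1 hxA
      simp [hxA, hx']
  refine hgrad.trans ?_
  have hN : eLpNorm (fun x => f x (weakGradient Ω ustar x) + a x) (ENNReal.ofReal σ)
      ((volume.restrict Ω).restrict A) ≤ eLpNorm (fun x => f x (weakGradient Ω ustar x) + a x)
      (ENNReal.ofReal σ) (volume.restrict Ω) := eLpNorm_restrict_le _ _ _ _
  have hFm : AEStronglyMeasurable (fun x => f x (weakGradient Ω ustar x) + a x)
      ((volume.restrict Ω).restrict A) := (hfs.1.add ha.1).restrict
  have hmu : ((volume.restrict Ω).restrict A) Set.univ = (volume.restrict Ω) A := by simp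
  have b1 := eLpNorm_one_le_of_lintegral_rpow_le
    (measurable_mulLog.comp_aemeasurable hUm.restrict.norm.aemeasurable).aestronglyMeasurable
    hFm hp hσ (hmin.lintegral_mulLog_le hΩ hs hfsi hai hν hp0 hf hk) hN
  have b2 := eLpNorm_one_le_of_lintegral_rpow_le
    (measurable_mulLog.comp_aemeasurable hUs.restrict.norm.aemeasurable).aestronglyMeasurable
    hFm hp hσ (lintegral_mulLog_star_le hν hp0 hf (weakGradient Ω ustar) A) hN
  rw [hmu] at b1 b2
  rw [two_mul]
  refine add_le_add ((lintegral_enorm_le_add_mulLog _ hs0).trans ?_)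
    ((lintegral_enorm_le_add_mulLog _ hs0).trans ?_)
  · rw [hmu]; gcongr; exact b1
  · rw [hmu]; gcongr; exact b2

/-- The basic decay estimate for the measures of the superlevel sets of `|u - u_*|`. -/
theorem IsMinimizer.level_estimate (hΩ : IsOpen Ω) (hb : Bornology.IsBounded Ω)
    (hmin : IsMinimizer Ω f ustar u) (hs : MemW11 Ω ustar) (hν : 0 < ν) (hp : 1 < p) (hσ : 1 < σ)
    (hf : ∀ᵐ x ∂(volume.restrict Ω), ∀ z : EuclideanSpace ℝ (Fin n),
        ν * ‖z‖ ^ p * Real.log (Real.exp 1 + ‖z‖) ^ p - a x ≤ f x z)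
    (ha : MemLp a (ENNReal.ofReal σ) (volume.restrict Ω))
    (hfs : MemLp (fun x => f x (weakGradient Ω ustar x)) (ENNReal.ofReal σ) (volume.restrict Ω))
    {q : NNReal} (hq : NNReal.HolderConjugate (n : NNReal) q)
    {s k h : ℝ} (hs0 : 0 ≤ s) (hk : 0 < k) (hkh : k < h) :
    (h - k) * (volume.restrict Ω).real {x | h < |u x - ustar x|} ^ (1 - 1 / (n : ℝ)) ≤
      2 * eLpNormLESNormFDerivOneConst (volume : Measure (EuclideanSpace ℝ (Fin n))) q *
      (s * (volume.restrict Ω).real {x | k < |u x - ustar x|} +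
        (Real.log (Real.exp 1 + s))⁻¹ *
          ((1 / ν * (eLpNorm (fun x => f x (weakGradient Ω ustar x) + a x)
            (ENNReal.ofReal σ) (volume.restrict Ω)).toReal) ^ (1 / p) *
          (volume.restrict Ω).real {x | k < |u x - ustar x|} ^ (1 - 1 / (p * σ)))) := by
  have hfin : IsFiniteMeasure (volume.restrict Ω) :=
    isFiniteMeasure_restrict.2 hb.measure_lt_top.ne
  have hmain := hmin.level_estimate_enn hΩ hb hs hν hp hσ hf ha hfs hq hs0 (h := h) hk
  have hq1 : 1 / (q : ℝ) = 1 - 1 / (n : ℝ) := by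
    have := hq.coe.inv_add_inv_eq_one
    simp only [NNReal.coe_natCast] at this
    rw [one_div, one_div]; linarith
  have hN : eLpNorm (fun x => f x (weakGradient Ω ustar x) + a x)
      (ENNReal.ofReal σ) (volume.restrict Ω) ≠ ⊤ := (hfs.add ha).2.ne
  have hpσ : 0 ≤ 1 - 1 / (p * σ) := by
    have : 1 < p * σ := by nlinarith
    rw [sub_nonneg, div_le_one (by linarith)]; exact this.le
  have hlog := one_le_log_exp_one_add hs0
  rw [hq1] at hmain
  have hR : ENNReal.ofReal (Real.log (Real.exp 1 + s))⁻¹ *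
      ((ENNReal.ofReal (1 / ν) * eLpNorm (fun x => f x (weakGradient Ω ustar x) + a x)
        (ENNReal.ofReal σ) (volume.restrict Ω)) ^ (1 / p) *
      (volume.restrict Ω) {x | k < |u x - ustar x|} ^ (1 - 1 / (p * σ))) ≠ ⊤ :=
    ENNReal.mul_ne_top (by simp) (ENNReal.mul_ne_top
      (ENNReal.rpow_ne_top_of_nonneg (by positivity) (ENNReal.mul_ne_top (by simp) hN))
      (ENNReal.rpow_ne_top_of_nonneg hpσ (measure_ne_top _ _)))
  have h1 := ENNReal.toReal_mono ?_ hmain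
  · rw [ENNReal.toReal_mul, ENNReal.toReal_mul, ENNReal.toReal_mul, ENNReal.toReal_add,
      ENNReal.toReal_mul, ENNReal.toReal_mul, ENNReal.toReal_mul, ← ENNReal.toReal_rpow,
      ← ENNReal.toReal_rpow, ← ENNReal.toReal_rpow, ENNReal.toReal_mul,
      ENNReal.toReal_ofReal (by linarith), ENNReal.toReal_ofReal hs0,
      ENNReal.toReal_ofReal (by positivity), ENNReal.toReal_ofReal (by positivity)] at h1
    · simp only [measureReal_def]
      refine h1.trans (le_of_eq ?_)
      simp only [ENNReal.coe_toReal, ENNReal.toReal_ofNat]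
      ring
    · finiteness
    · exact hR
  · exact ENNReal.mul_ne_top (by simp) (ENNReal.mul_ne_top (by simp)
      (ENNReal.add_ne_top.2 ⟨by finiteness, hR⟩))

end Minimizer

end Sobolev

/-! ### Decay lemmas of Stampacchia type -/

theorem monotoneOn_mulLog : MonotoneOn mulLog (Set.Ici 0) := by
  intro s hs t ht hst
  have hs' : 0 ≤ s := hs
  have h1 := one_le_log_exp_one_add hs'
  unfold mulLog
  gcongr

theorem self_le_mulLog {t : ℝ} (ht : 0 ≤ t) : t ≤ mulLog t :=
  le_mul_of_one_le_right ht (one_le_log_exp_one_add ht)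

theorem mulLog_two_mul_le {t : ℝ} (ht : 0 ≤ t) : mulLog (2 * t) ≤ 4 * mulLog t := by
  have h1 := one_le_log_exp_one_add ht
  have h2 : Real.log (Real.exp 1 + 2 * t) ≤ 2 * Real.log (Real.exp 1 + t) := by
    rw [← Real.log_rpow (by positivity)]
    refine Real.log_le_log (by positivity) ?_
    have := Real.add_one_le_exp 1
    norm_num
    nlinarith [Real.exp_pos 1]
  unfold mulLog
  nlinarith

/-- Subadditivity of t ↦ t^θ: (e+k)^θ ≤ e^θ + k^θ ≤ e + k^θ. -/
theorem log_exp_one_add_rpow_ge {θ k : ℝ} (hθ0 : 0 < θ) (hθ1 : θ ≤ 1) (hk : 0 ≤ k) :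
    θ * Real.log (Real.exp 1 + k) ≤ Real.log (Real.exp 1 + k ^ θ) := by
  rw [← Real.log_rpow (by positivity)]
  refine Real.log_le_log (by positivity) ?_
  refine (Real.rpow_add_le_add_rpow (Real.exp_pos 1).le hk hθ0.le hθ1).trans ?_
  gcongr
  rw [Real.exp_one_rpow]
  exact Real.exp_le_exp.2 hθ1

theorem log_exp_one_add_le_rpow {θ k : ℝ} (hθ0 : 0 < θ) (hk : 1 ≤ k) :
    Real.log (Real.exp 1 + k) ≤ (Real.exp 1 + 1) ^ θ / θ * k ^ θ := by
  refine (Real.log_le_rpow_div (by positivity) hθ0).trans ?_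
  rw [div_mul_eq_mul_div, ← Real.mul_rpow (by positivity) (by positivity)]
  gcongr
  nlinarith [Real.exp_pos 1]

/-- Stampacchia's lemma, supercritical case. -/
theorem exists_eq_zero_of_decay {φ : ℝ → ℝ} (h0 : ∀ k, 0 ≤ φ k) (hmono : Antitone φ)
    {a b C : ℝ} (ha : 0 < a) (hab : a < b) (hC : 0 ≤ C)
    (hφ : ∀ k h, 1 ≤ k → k < h → (h - k) * φ h ^ a ≤ C * φ k ^ b) : ∃ d, φ d = 0 := by
  have hba : 0 < b - a := by linarith
  set A := φ 1 + 1 with hA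
  have hA0 : 0 < A := by have := h0 1; linarith
  -- The target is φ(k_j) ≤ A r^j on levels k_j increasing to 1 + d with halving gaps. The choice
  -- r^{b-a} = 1/2 compensates the halving, and d is large enough for the induction step to close.
  set r : ℝ := (1 / 2) ^ (1 / (b - a)) with hr
  have hr0 : 0 < r := by positivity
  have hr1 : r < 1 := Real.rpow_lt_one (by norm_num) (by norm_num) (by positivity)
  have hrp : r ^ (b - a) = 1 / 2 := by
    rw [hr, ← Real.rpow_mul (by norm_num), one_div_mul_cancel hba.ne', Real.rpow_one]
  set d := 2 * C * A ^ (b - a) / r ^ a + 1 with hd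
  have hd0 : 0 < d := by positivity
  have hdr : 2 * C * A ^ (b - a) ≤ d * r ^ a := by
    rw [hd, add_mul, div_mul_cancel₀ _ (by positivity)]
    have : 0 < r ^ a := by positivity
    linarith
  set k : ℕ → ℝ := fun j => 1 + d * (1 - (1 / 2) ^ j) with hk
  have hk1 : ∀ j, 1 ≤ k j := fun j => by
    have : (1 / 2 : ℝ) ^ j ≤ 1 := pow_le_one₀ (by norm_num) (by norm_num)
    have : 0 ≤ d * (1 - (1 / 2) ^ j) := mul_nonneg hd0.le (by linarith)
    simp only [hk]; linarith
  have hdiff : ∀ j, k (j + 1) - k j = d * (1 / 2) ^ (j + 1) := fun j => by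
    simp only [hk, pow_succ]; ring
  have hbound : ∀ j, φ (k j) ≤ A * r ^ j := by
    intro j
    induction j with
    | zero => simp [hk, hA]
    | succ j ih =>
      have hpos : 0 < k (j + 1) - k j := by rw [hdiff]; positivity
      have h1 := hφ (k j) (k (j + 1)) (hk1 j) (by linarith)
      have h2 : φ (k j) ^ b ≤ (A * r ^ j) ^ b := Real.rpow_le_rpow (h0 _) ih (by linarith)
      have h3 : (A * r ^ j) ^ b = (A * r ^ j) ^ a * (A ^ (b - a) * (1 / 2) ^ j) := by
        have e1 : (r ^ j) ^ (b - a) = (1 / 2) ^ j := by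
          rw [← Real.rpow_natCast r j, ← Real.rpow_mul hr0.le, mul_comm, Real.rpow_mul hr0.le, hrp,
            Real.rpow_natCast]
        rw [← e1, ← Real.mul_rpow hA0.le (by positivity), ← Real.rpow_add (by positivity)]
        congr 1; ring
      have h4 : (A * r ^ (j + 1)) ^ a = (A * r ^ j) ^ a * r ^ a := by
        rw [pow_succ, ← mul_assoc, Real.mul_rpow (by positivity) hr0.le]
      rw [← Real.rpow_le_rpow_iff (h0 _) (by positivity) ha, h4]
      rw [hdiff] at h1
      have h5 : d * (1 / 2) ^ (j + 1) * φ (k (j + 1)) ^ a ≤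
          d * (1 / 2) ^ (j + 1) * ((A * r ^ j) ^ a * r ^ a) := by
        calc _ ≤ C * φ (k j) ^ b := h1
          _ ≤ C * ((A * r ^ j) ^ a * (A ^ (b - a) * (1 / 2) ^ j)) := by rw [← h3]; gcongr
          _ = (2 * C * A ^ (b - a)) * ((A * r ^ j) ^ a * (1 / 2) ^ (j + 1)) := by
              rw [pow_succ]; ring
          _ ≤ (d * r ^ a) * ((A * r ^ j) ^ a * (1 / 2) ^ (j + 1)) := by gcongr
          _ = _ := by ring
      exact le_of_mul_le_mul_left h5 (by positivity)
  refine ⟨1 + d, le_antisymm ?_ (h0 _)⟩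
  have hlim : Tendsto (fun j : ℕ => A * r ^ j) atTop (𝓝 0) := by
    simpa using (tendsto_pow_atTop_nhds_zero_of_lt_one hr0.le hr1).const_mul A
  refine ge_of_tendsto' hlim fun j => (hmono ?_).trans (hbound j)
  have : 0 < (1 / 2 : ℝ) ^ j := by positivity
  simp only [hk]
  nlinarith

/-- Stampacchia's lemma, critical case. -/
theorem exp_decay_of_decay {φ : ℝ → ℝ} (h0 : ∀ k, 0 ≤ φ k)
    {a C δ : ℝ} (ha : 0 < a) (ha1 : a ≤ 1) (hδ : 0 < δ) (hCδ : Real.exp 1 * C ≤ δ)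
    (hφ : ∀ k h, 0 < k → k < h → (h - k) * φ h ^ a ≤ C * φ k ^ a) (j : ℕ) :
    φ (δ * (j + 1)) ≤ φ δ * Real.exp (-j) := by
  induction j with
  | zero => simp
  | succ j ih =>
    have h1 := hφ (δ * (j + 1)) (δ * ((j + 1 : ℕ) + 1)) (by positivity)
      (by push_cast; nlinarith)
    have h2 : δ * ((j + 1 : ℕ) + 1) - δ * (j + 1) = δ := by push_cast; ring
    rw [h2] at h1
    -- Raising the level by δ gains a factor C/δ ≤ e^{-1} on φ^a, and e^{-1} ≤ e^{-a} because a ≤ 1.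
    have h3 : φ (δ * ((j + 1 : ℕ) + 1)) ≤ Real.exp (-1) * φ (δ * (j + 1)) := by
      rw [← Real.rpow_le_rpow_iff (h0 _) (mul_nonneg (Real.exp_pos _).le (h0 _)) ha,
        Real.mul_rpow (Real.exp_pos _).le (h0 _)]
      have h4 : Real.exp (-1) ≤ Real.exp (-1) ^ a := by
        rw [← Real.exp_mul]
        exact Real.exp_le_exp.2 (by linarith)
      have h5 : 0 ≤ φ (δ * (j + 1)) ^ a := Real.rpow_nonneg (h0 _) _
      have h6 : C ≤ δ * Real.exp (-1) := by
        rw [Real.exp_neg, ← div_eq_mul_inv, le_div_iff₀ (Real.exp_pos _)]; linarith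
      have h7 : δ * φ (δ * ((j + 1 : ℕ) + 1)) ^ a ≤
          δ * (Real.exp (-1) ^ a * φ (δ * (j + 1)) ^ a) := by
        calc _ ≤ C * φ (δ * (j + 1)) ^ a := h1
          _ ≤ (δ * Real.exp (-1) ^ a) * φ (δ * (j + 1)) ^ a := by
              gcongr
              exact h6.trans (by gcongr)
          _ = _ := by ring
      exact le_of_mul_le_mul_left h7 hδ
    refine h3.trans ?_
    have : Real.exp (-((j + 1 : ℕ) : ℝ)) = Real.exp (-1) * Real.exp (-j) := by
      rw [← Real.exp_add]; congr 1; push_cast; ring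
    rw [this]
    calc _ ≤ Real.exp (-1) * (φ δ * Real.exp (-j)) := by gcongr
      _ = _ := by ring

/-- On the layer δ(j+1) < g ≤ δ(j+2) the exponential is at most e^{(j+2)/2}, against measure C
e^{-j}. The 2 in the exponent leaves a geometric series of ratio e^{-1/2}. -/
theorem integrable_exp_of_decay {α : Type*} [MeasurableSpace α] {μ : Measure α} [IsFiniteMeasure μ]
    {g : α → ℝ} (hg : AEMeasurable g μ) {δ C : ℝ} (hδ : 0 < δ)
    (hdec : ∀ j : ℕ, μ.real {x | δ * (j + 1) < g x} ≤ C * Real.exp (-j)) :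
    Integrable (fun x => Real.exp (g x / (2 * δ))) μ := by
  have hm : ∀ t : ℝ, NullMeasurableSet {x | t < g x} μ := fun t =>
    nullMeasurableSet_lt aemeasurable_const hg
  have hC : 0 ≤ C := by simpa using measureReal_nonneg.trans (hdec 0)
  refine ⟨(Real.measurable_exp.comp_aemeasurable (hg.div_const _)).aestronglyMeasurable, ?_⟩
  rw [hasFiniteIntegral_iff_ofReal (Eventually.of_forall fun x => (Real.exp_pos _).le)]
  have hpt : ∀ x, ENNReal.ofReal (Real.exp (g x / (2 * δ))) ≤ ENNReal.ofReal (Real.exp 1) +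
      ∑' j : ℕ, {x | δ * (j + 1) < g x}.indicator
        (fun _ => ENNReal.ofReal (Real.exp ((j + 2) / 2))) x := by
    intro x
    rcases le_or_gt (g x) δ with h | h
    · refine le_add_right (ENNReal.ofReal_le_ofReal (Real.exp_le_exp.2 ?_))
      rw [div_le_one (by positivity)]; linarith
    · refine le_add_left ?_
      have h1 : 1 < g x / δ := by rwa [lt_div_iff₀ hδ, one_mul]
      obtain ⟨j, hj⟩ : ∃ j : ℕ, ⌈g x / δ⌉₊ = j + 2 := by
        have : 1 < ⌈g x / δ⌉₊ := Nat.lt_ceil.2 (by simpa using h1)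
        exact ⟨⌈g x / δ⌉₊ - 2, by omega⟩
      have h2 : (j : ℝ) + 1 < g x / δ := by
        have : j + 1 < ⌈g x / δ⌉₊ := by omega
        have := Nat.lt_ceil.1 this
        exact_mod_cast this
      have h3 : g x / δ ≤ j + 2 := by
        have := Nat.le_ceil (g x / δ)
        rw [hj] at this
        exact_mod_cast this
      refine le_trans ?_ (ENNReal.le_tsum j)
      rw [Set.indicator_of_mem (by
        change δ * (j + 1) < g x
        rw [lt_div_iff₀ hδ] at h2; linarith)]
      refine ENNReal.ofReal_le_ofReal (Real.exp_le_exp.2 ?_)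
      rw [mul_comm, ← div_div]
      gcongr
  refine (lintegral_mono hpt).trans_lt ?_
  rw [lintegral_add_left measurable_const, lintegral_tsum fun j => aemeasurable_const.indicator₀ (hm _),
    lintegral_const]
  refine ENNReal.add_lt_top.2 ⟨ENNReal.mul_lt_top (by simp) (measure_lt_top _ _), ?_⟩
  have hterm : ∀ j : ℕ, ∫⁻ x, {x | δ * (j + 1) < g x}.indicator
        (fun _ => ENNReal.ofReal (Real.exp ((j + 2) / 2))) x ∂μ ≤
      ENNReal.ofReal (C * Real.exp 1 * Real.exp (-(1 / 2)) ^ j) := by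
    intro j
    rw [lintegral_indicator_const₀ (hm _), ← ofReal_measureReal, ← ENNReal.ofReal_mul (by positivity)]
    refine ENNReal.ofReal_le_ofReal ?_
    calc Real.exp ((j + 2) / 2) * μ.real {x | δ * (j + 1) < g x}
        ≤ Real.exp ((j + 2) / 2) * (C * Real.exp (-j)) := by gcongr; exact hdec j
      _ = C * (Real.exp ((j + 2) / 2) * Real.exp (-j)) := by ring
      _ = C * (Real.exp 1 * Real.exp (-(1 / 2)) ^ j) := by
          rw [← Real.exp_nat_mul, ← Real.exp_add, ← Real.exp_add]; congr 2; ring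
      _ = _ := by ring
  refine (ENNReal.tsum_le_tsum hterm).trans_lt ?_
  have hsum : Summable fun j : ℕ => C * Real.exp 1 * Real.exp (-(1 / 2)) ^ j :=
    (summable_geometric_of_lt_one (Real.exp_pos _).le
      (Real.exp_lt_one_iff.2 (by norm_num))).mul_left _
  rw [← ENNReal.ofReal_tsum_of_nonneg (fun j => by positivity) hsum]
  exact ENNReal.ofReal_lt_top

/-- Absorption of the lower-order term in the decay estimate. -/
theorem mulLog_decay_of_decay {φ : ℝ → ℝ} (h0 : ∀ k, 0 ≤ φ k) {a b c C K : ℝ}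
    (hb : 0 < b) (hb1 : b < 1) (hc : 0 ≤ c) (hC : 0 ≤ C) (hK : 0 ≤ K)
    (hcheb : ∀ k, 1 ≤ k → k * φ k ≤ c)
    (hφ : ∀ s k h, 0 ≤ s → 1 ≤ k → k < h →
      (h - k) * φ h ^ a ≤ C * (s * φ k + (Real.log (Real.exp 1 + s))⁻¹ * (K * φ k ^ b))) :
    ∃ D, 0 ≤ D ∧ ∀ k, 1 ≤ k → mulLog k * φ (2 * k) ^ a ≤ D * φ k ^ b := by
  -- With s = k^θ, one factor k^θ is s itself and a second one dominates ln(e+k). Since 2θ = 1 - b,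
  -- together they give k^{2θ} φ^{1-b} = (kφ)^{1-b} ≤ c^{1-b}.
  set θ := (1 - b) / 2 with hθ
  have hθ0 : 0 < θ := by rw [hθ]; linarith
  have hθ1 : θ ≤ 1 := by rw [hθ]; linarith
  refine ⟨C * (c ^ (1 - b) * ((Real.exp 1 + 1) ^ θ / θ) + K / θ), by positivity, fun k hk => ?_⟩
  have hk0 : 0 < k := by linarith
  have h1 := hφ (k ^ θ) k (2 * k) (by positivity) hk (by linarith)
  have hl := one_le_log_exp_one_add hk0.le
  have hl0 : 0 < Real.log (Real.exp 1 + k) := by linarith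
  have hlθ := log_exp_one_add_rpow_ge hθ0 hθ1 hk0.le
  have hφb : 0 ≤ φ k ^ b := Real.rpow_nonneg (h0 k) _
  have h2 : Real.log (Real.exp 1 + k) * (k ^ θ * φ k) ≤
      c ^ (1 - b) * ((Real.exp 1 + 1) ^ θ / θ) * φ k ^ b := by
    have e1 : φ k = φ k ^ (1 - b) * φ k ^ b := by
      rw [← Real.rpow_add_of_nonneg (h0 k) (by linarith) hb.le]; simp
    have e2 : k ^ θ * k ^ θ * φ k ^ (1 - b) ≤ c ^ (1 - b) := by
      rw [← Real.rpow_add hk0, hθ, add_halves, ← Real.mul_rpow hk0.le (h0 k)]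
      exact Real.rpow_le_rpow (mul_nonneg hk0.le (h0 k)) (hcheb k hk) (by linarith)
    have hφ1 : 0 ≤ φ k ^ (1 - b) := Real.rpow_nonneg (h0 k) _
    calc Real.log (Real.exp 1 + k) * (k ^ θ * φ k)
        ≤ ((Real.exp 1 + 1) ^ θ / θ * k ^ θ) * (k ^ θ * φ k) := by
          have := log_exp_one_add_le_rpow hθ0 hk
          have := h0 k
          gcongr
      _ = ((Real.exp 1 + 1) ^ θ / θ) * (k ^ θ * k ^ θ * φ k ^ (1 - b)) * φ k ^ b := by
          nth_rw 1 [e1]; ring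
      _ ≤ ((Real.exp 1 + 1) ^ θ / θ) * c ^ (1 - b) * φ k ^ b := by gcongr
      _ = _ := by ring
  have h3 : Real.log (Real.exp 1 + k) * ((Real.log (Real.exp 1 + k ^ θ))⁻¹ * (K * φ k ^ b)) ≤
      K / θ * φ k ^ b := by
    have e1 : Real.log (Real.exp 1 + k) * (Real.log (Real.exp 1 + k ^ θ))⁻¹ ≤ 1 / θ := by
      rw [← div_eq_mul_inv, div_le_div_iff₀ (by nlinarith) hθ0]
      linarith
    calc _ = (Real.log (Real.exp 1 + k) * (Real.log (Real.exp 1 + k ^ θ))⁻¹) * (K * φ k ^ b) := by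
          ring
      _ ≤ 1 / θ * (K * φ k ^ b) := by gcongr
      _ = _ := by ring
  have e : 2 * k - k = k := by ring
  rw [e] at h1
  calc mulLog k * φ (2 * k) ^ a = Real.log (Real.exp 1 + k) * (k * φ (2 * k) ^ a) := by
        unfold mulLog; ring
    _ ≤ Real.log (Real.exp 1 + k) * (C * (k ^ θ * φ k +
          (Real.log (Real.exp 1 + k ^ θ))⁻¹ * (K * φ k ^ b))) := by gcongr
    _ = C * (Real.log (Real.exp 1 + k) * (k ^ θ * φ k) + Real.log (Real.exp 1 + k) *
          ((Real.log (Real.exp 1 + k ^ θ))⁻¹ * (K * φ k ^ b))) := by ring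
    _ ≤ C * (c ^ (1 - b) * ((Real.exp 1 + 1) ^ θ / θ) * φ k ^ b + K / θ * φ k ^ b) := by gcongr
    _ = _ := by ring

/-- Stampacchia's lemma, subcritical case, with a logarithmic gain along dyadic levels. -/
theorem dyadic_bound_of_mulLog_decay {φ : ℝ → ℝ} (h0 : ∀ k, 0 ≤ φ k) {a b D : ℝ}
    (hb : 0 < b) (hba : b < a) (hD : 0 ≤ D)
    (hφ : ∀ k, 1 ≤ k → mulLog k * φ (2 * k) ^ a ≤ D * φ k ^ b) :
    ∃ B, 0 ≤ B ∧ ∀ j : ℕ, φ (2 ^ j) * mulLog (2 ^ j) ^ (1 / (a - b)) ≤ B := by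
  set m := 1 / (a - b) with hm
  have hab : 0 < a - b := by linarith
  have hm0 : 0 < m := by positivity
  have ha : 0 < a := by linarith
  have hL : ∀ j : ℕ, 0 < mulLog (2 ^ j) := fun j =>
    lt_of_lt_of_le (by positivity) (self_le_mulLog (by positivity))
  set D' := 4 ^ (m * a) * D with hD'
  have hD'0 : 0 ≤ D' := by positivity
  -- The first entry starts the induction. The second gives D' ≤ B^{a-b}, so that D' B^b ≤ B^a
  -- reproduces the bound; the powers of the weight match because ma = 1 + mb.
  set B := max (φ 1 * mulLog 1 ^ m) (D' ^ m) with hB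
  have hB0 : 0 ≤ B := le_max_of_le_right (by positivity)
  have hDB : D' ≤ B ^ (a - b) := by
    have : D' = (D' ^ m) ^ (a - b) := by
      rw [← Real.rpow_mul hD'0, hm, one_div_mul_cancel hab.ne', Real.rpow_one]
    rw [this]
    exact Real.rpow_le_rpow (by positivity) (le_max_right _ _) hab.le
  refine ⟨B, hB0, fun j => ?_⟩
  induction j with
  | zero => rw [pow_zero]; exact le_max_left _ _
  | succ j ih =>
    have hLj := hL j
    have h1 := hφ (2 ^ j) (one_le_pow₀ (by norm_num))
    have e2 : (2 : ℝ) ^ (j + 1) = 2 * 2 ^ j := by ring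
    have h4 : mulLog (2 ^ (j + 1)) ≤ 4 * mulLog (2 ^ j) := by
      rw [e2]; exact mulLog_two_mul_le (by positivity)
    have hφ1 : 0 ≤ φ (2 * 2 ^ j) ^ a := Real.rpow_nonneg (h0 _) _
    have hLs := hL (j + 1)
    rw [← Real.rpow_le_rpow_iff (mul_nonneg (h0 _) (by positivity)) hB0 ha,
      Real.mul_rpow (h0 _) (by positivity), ← Real.rpow_mul hLs.le]
    have e3 : mulLog (2 ^ j) ^ (m * a) = mulLog (2 ^ j) * mulLog (2 ^ j) ^ (m * b) := by
      nth_rw 2 [← Real.rpow_one (mulLog (2 ^ j))]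
      rw [← Real.rpow_add hLj]
      congr 1
      rw [hm]; field_simp; ring
    calc φ (2 ^ (j + 1)) ^ a * mulLog (2 ^ (j + 1)) ^ (m * a)
        ≤ φ (2 * 2 ^ j) ^ a * (4 * mulLog (2 ^ j)) ^ (m * a) := by
          rw [e2] at *; gcongr
      _ = 4 ^ (m * a) * (mulLog (2 ^ j) * φ (2 * 2 ^ j) ^ a) * mulLog (2 ^ j) ^ (m * b) := by
          rw [Real.mul_rpow (by norm_num) hLj.le, e3]; ring
      _ ≤ 4 ^ (m * a) * (D * φ (2 ^ j) ^ b) * mulLog (2 ^ j) ^ (m * b) := by gcongr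
      _ = D' * (φ (2 ^ j) * mulLog (2 ^ j) ^ m) ^ b := by
          rw [Real.mul_rpow (h0 _) (by positivity), ← Real.rpow_mul hLj.le]; ring
      _ ≤ B ^ (a - b) * B ^ b := by
          have : 0 ≤ φ (2 ^ j) * mulLog (2 ^ j) ^ m := mul_nonneg (h0 _) (by positivity)
          gcongr
      _ = B ^ a := by rw [← Real.rpow_add_of_nonneg hB0 hab.le hb.le]; simp

/-- Doubling lets each large l be compared with a dyadic level: L(2^j) ≤ l < L(2^{j+1}) ≤ 4 L(2^j)
for L(t) = t ln(e+t). Small l are covered by the bound T. -/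
theorem weak_bound_of_dyadic_bound {φ ψ : ℝ → ℝ} {m B T : ℝ} (hm : 0 < m) (hB : 0 ≤ B) (hT : 0 ≤ T)
    (hφ : ∀ j : ℕ, φ (2 ^ j) * mulLog (2 ^ j) ^ m ≤ B)
    (hψφ : ∀ l k, 0 < k → mulLog k ≤ l → ψ l ≤ φ k) (hψ : ∀ l, ψ l ≤ T) :
    ∃ γ, ∀ l, 0 < l → ψ l ≤ γ / l ^ m := by
  have hL : ∀ j : ℕ, 0 < mulLog (2 ^ j) := fun j =>
    lt_of_lt_of_le (by positivity) (self_le_mulLog (by positivity))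
  have hL1 : 0 < mulLog 1 := by simpa using hL 0
  refine ⟨T * mulLog 1 ^ m + B * 4 ^ m, fun l hl => ?_⟩
  have hlm : 0 < l ^ m := by positivity
  rw [le_div_iff₀ hlm]
  have hT' : 0 ≤ T * mulLog 1 ^ m := by positivity
  have hB' : 0 ≤ B * 4 ^ m := by positivity
  rcases le_or_gt l (mulLog 1) with h | h
  · have : ψ l * l ^ m ≤ T * mulLog 1 ^ m := by
      have := hψ l
      gcongr
    linarith
  · have hex : ∃ j : ℕ, l < mulLog (2 ^ j) := by
      obtain ⟨j, hj⟩ := pow_unbounded_of_one_lt l (by norm_num : (1 : ℝ) < 2)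
      exact ⟨j, hj.trans_le (self_le_mulLog (by positivity))⟩
    classical
    obtain ⟨j, hj⟩ : ∃ j, Nat.find hex = j + 1 := by
      refine Nat.exists_eq_succ_of_ne_zero fun h' => ?_
      have := Nat.find_spec hex
      rw [h', pow_zero] at this
      linarith
    have h1 : l < mulLog (2 ^ (j + 1)) := hj ▸ Nat.find_spec hex
    have h2 : mulLog (2 ^ j) ≤ l := not_lt.1 (Nat.find_min hex (by omega : j < Nat.find hex))
    have h3 : l ≤ 4 * mulLog (2 ^ j) := by
      rw [pow_succ, mul_comm] at h1
      exact h1.le.trans (mulLog_two_mul_le (by positivity))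
    have h4 := hφ j
    have hLj := hL j
    have h5 : φ (2 ^ j) ≤ B / mulLog (2 ^ j) ^ m := by rwa [le_div_iff₀ (by positivity)]
    calc ψ l * l ^ m ≤ (B / mulLog (2 ^ j) ^ m) * l ^ m := by
          gcongr
          exact (hψφ l _ (by positivity) h2).trans h5
      _ ≤ (B / mulLog (2 ^ j) ^ m) * (4 * mulLog (2 ^ j)) ^ m := by gcongr
      _ = B * 4 ^ m := by
          rw [Real.mul_rpow (by norm_num) hLj.le]; field_simp
      _ ≤ _ := by linarith

/-! ### The three regimes -/

theorem mainTheorem10 (n : ℕ) (hn : 2 ≤ n) (p ν : ℝ) (hp1 : 1 < p) (hpn : p < n) (hν : 0 < ν) :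
    ∃ τ : ℝ → ℝ, (∀ M : ℝ, 0 < τ M) ∧
      ∀ (σ : ℝ), 1 < σ →
      ∀ (Ω : Set (EuclideanSpace ℝ (Fin n))), IsOpen Ω → Bornology.IsBounded Ω →
      ∀ (f : EuclideanSpace ℝ (Fin n) → EuclideanSpace ℝ (Fin n) → ℝ), IsCaratheodory Ω f →
      ∀ (a : EuclideanSpace ℝ (Fin n) → ℝ), (∀ x ∈ Ω, 0 ≤ a x) →
      (∀ᵐ x ∂(volume.restrict Ω), ∀ z : EuclideanSpace ℝ (Fin n),
        ν * ‖z‖ ^ p * Real.log (Real.exp 1 + ‖z‖) ^ p - a x ≤ f x z) →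
      ∀ (ustar : EuclideanSpace ℝ (Fin n) → ℝ), MemW11 Ω ustar →
      MemLp a (ENNReal.ofReal σ) (volume.restrict Ω) →
      MemLp (fun x => f x (weakGradient Ω ustar x)) (ENNReal.ofReal σ) (volume.restrict Ω) →
      ∀ (u : EuclideanSpace ℝ (Fin n) → ℝ), IsMinimizer Ω f ustar u →
        ((n / p < σ →
            MemLp (fun x => |u x - ustar x| * Real.log (Real.exp 1 + |u x - ustar x|)) ∞
              (volume.restrict Ω)) ∧
          (σ = n / p →
            IntegrableOn (fun x => Real.exp (|u x - ustar x| /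
              (2 * τ (eLpNorm (fun x => f x (weakGradient Ω ustar x) + a x) (ENNReal.ofReal σ)
                (volume.restrict Ω)).toReal))) Ω) ∧
          (σ < n / p →
            MemMarcinkiewicz Ω (n * p * σ / (n - p * σ))
              (fun x => |u x - ustar x| * Real.log (Real.exp 1 + |u x - ustar x|)))) := by
  have hn1 : (1 : NNReal) < n := by exact_mod_cast hn
  have hq := NNReal.HolderConjugate.conjExponent hn1
  set q := NNReal.conjExponent (n : NNReal)
  set S := eLpNormLESNormFDerivOneConst (volume : Measure (EuclideanSpace ℝ (Fin n))) q
  -- This is e times the constant of the decay inequality at s = 0, as the critical decay lemma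
  -- requires; the added 1 and |M| ensure positivity for every real M.
  refine ⟨fun M => Real.exp 1 * (2 * S * (1 / ν * |M|) ^ (1 / p)) + 1, fun M => by positivity, ?_⟩
  intro σ hσ Ω hΩ hb f _ a _ hf ustar hs ha hfs u hmin
  have hfin : IsFiniteMeasure (volume.restrict Ω) :=
    isFiniteMeasure_restrict.2 hb.measure_lt_top.ne
  set M := (eLpNorm (fun x => f x (weakGradient Ω ustar x) + a x) (ENNReal.ofReal σ)
    (volume.restrict Ω)).toReal with hM
  have hM0 : 0 ≤ M := ENNReal.toReal_nonneg
  set K := (1 / ν * M) ^ (1 / p) with hK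
  have hK0 : 0 ≤ K := by positivity
  set φ : ℝ → ℝ := fun k => (volume.restrict Ω).real {x | k < |u x - ustar x|} with hφ
  have hφ0 : ∀ k, 0 ≤ φ k := fun k => measureReal_nonneg
  have hφmono : Antitone φ := fun k h hkh => measureReal_mono fun x hx => lt_of_le_of_lt hkh hx
  have hlev : ∀ s k h : ℝ, 0 ≤ s → 0 < k → k < h → (h - k) * φ h ^ (1 - 1 / (n : ℝ)) ≤
      2 * S * (s * φ k + (Real.log (Real.exp 1 + s))⁻¹ * (K * φ k ^ (1 - 1 / (p * σ)))) :=
    fun s k h h1 h2 h3 => hmin.level_estimate hΩ hb hs hν hp1 hσ hf ha hfs hq h1 h2 h3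
  -- At s = 0 the linear term disappears and ln(e + s) = 1.
  have hlev0 : ∀ k h : ℝ, 0 < k → k < h → (h - k) * φ h ^ (1 - 1 / (n : ℝ)) ≤
      2 * S * K * φ k ^ (1 - 1 / (p * σ)) := fun k h h2 h3 => by
    have := hlev 0 k h le_rfl h2 h3
    simpa [mul_assoc] using this
  have hn0 : (0 : ℝ) < n := by linarith
  have hn2 : (2 : ℝ) ≤ n := by exact_mod_cast hn
  have hp0 : 0 < p := by linarith
  have hpσ : 1 < p * σ := by nlinarith
  have hA0 : 0 < 1 - 1 / (n : ℝ) := by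
    rw [sub_pos, div_lt_one hn0]; linarith
  have hA1 : 1 - 1 / (n : ℝ) ≤ 1 := by
    have : 0 < 1 / (n : ℝ) := by positivity
    linarith
  have hvi : Integrable (fun x => u x - ustar x) (volume.restrict Ω) :=
    (hmin.sobolevZero hΩ).integrableOn
  have hvm : AEMeasurable (fun x => |u x - ustar x|) (volume.restrict Ω) := hvi.1.aemeasurable.abs
  have hLm : AEMeasurable (fun x => mulLog |u x - ustar x|) (volume.restrict Ω) :=
    measurable_mulLog.comp_aemeasurable hvm
  refine ⟨fun hσn => ?_, fun hσn => ?_, fun hσn => ?_⟩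
  · rw [div_lt_iff₀ hp0, mul_comm] at hσn
    obtain ⟨d, hd⟩ := exists_eq_zero_of_decay hφ0 hφmono hA0
      (b := 1 - 1 / (p * σ)) (by gcongr) (by positivity : 0 ≤ 2 * S * K)
      fun k h hk => hlev0 k h (by linarith)
    refine memLp_top_of_bound hLm.aestronglyMeasurable (mulLog (max d 0)) ?_
    have h1 : (volume.restrict Ω) {x | d < |u x - ustar x|} = 0 := by
      rwa [hφ, measureReal_eq_zero_iff] at hd
    have h2 : ∀ᵐ x ∂(volume.restrict Ω), ¬ d < |u x - ustar x| := by
      rw [ae_iff]; simpa using h1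
    filter_upwards [h2] with x hx
    change ‖mulLog |u x - ustar x|‖ ≤ _
    rw [Real.norm_of_nonneg (mulLog_nonneg (abs_nonneg _))]
    exact monotoneOn_mulLog (Set.mem_Ici.2 (abs_nonneg _)) (Set.mem_Ici.2 (le_max_right _ _))
      ((not_lt.1 hx).trans (le_max_left _ _))
  -- In the critical case both exponents equal 1 - 1/n.
  · have e : p * σ = n := by rw [hσn]; field_simp
    rw [e] at hlev0
    beta_reduce
    rw [abs_of_nonneg hM0]
    set δ := Real.exp 1 * (2 * S * K) + 1
    have hδ : 0 < δ := by positivity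
    exact integrable_exp_of_decay hvm hδ (C := φ δ)
      (exp_decay_of_decay hφ0 hA0 hA1 hδ (by simp only [δ]; linarith) hlev0)
  · rw [lt_div_iff₀ hp0, mul_comm] at hσn
    have hB0 : 0 < 1 - 1 / (p * σ) := by
      rw [sub_pos, div_lt_one (by linarith)]; exact hpσ
    have hB1 : 1 - 1 / (p * σ) < 1 := by
      have : 0 < 1 / (p * σ) := by positivity
      linarith
    have hBA : 1 - 1 / (p * σ) < 1 - 1 / (n : ℝ) := by gcongr
    -- Chebyshev in L¹: the a priori decay of φ that absorbs the linear term.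
    have hcheb : ∀ k, 1 ≤ k → k * φ k ≤ ∫ x in Ω, |u x - ustar x| := fun k hk => by
      refine le_trans ?_ (mul_meas_ge_le_integral_of_nonneg
        (Eventually.of_forall fun x => abs_nonneg _) hvi.abs k)
      have : 0 ≤ k := by linarith
      gcongr
      exact measureReal_mono fun x (hx : k < |u x - ustar x|) => hx.le
    obtain ⟨D, hD0, hD⟩ := mulLog_decay_of_decay hφ0 hB0 hB1
      (integral_nonneg fun x => abs_nonneg _) (by positivity : (0 : ℝ) ≤ 2 * S) hK0 hcheb
      fun s k h h1 h2 h3 => hlev s k h h1 (by linarith) h3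
    obtain ⟨B, hBn, hB⟩ := dyadic_bound_of_mulLog_decay hφ0 hB0 hBA hD0 hD
    have hm : 1 / ((1 - 1 / (n : ℝ)) - (1 - 1 / (p * σ))) = n * p * σ / (n - p * σ) := by
      have h1 : (n : ℝ) - p * σ ≠ 0 := by linarith
      have h2 : (1 - 1 / (n : ℝ)) - (1 - 1 / (p * σ)) = (n - p * σ) / (n * p * σ) := by
        field_simp; ring
      rw [h2, one_div_div]
    have hm0 : 0 < 1 / ((1 - 1 / (n : ℝ)) - (1 - 1 / (p * σ))) :=
      one_div_pos.2 (by linarith)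
    obtain ⟨γ, hγ⟩ := weak_bound_of_dyadic_bound
      (ψ := fun l => (volume.restrict Ω).real {x | l < mulLog |u x - ustar x|})
      (T := (volume.restrict Ω).real Set.univ) hm0 hBn measureReal_nonneg hB
      (fun l k hk hkl => measureReal_mono fun x hx => by
        change k < |u x - ustar x|
        by_contra hcon
        have := monotoneOn_mulLog (abs_nonneg (u x - ustar x)) hk.le (not_lt.1 hcon)
        exact absurd hx (not_lt.2 (this.trans hkl)))
      (fun l => measureReal_mono (Set.subset_univ _))
    refine ⟨hLm, γ, fun l hl => ?_⟩
    have h1 := ENNReal.ofReal_le_ofReal (hγ l hl)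
    rw [hm, ofReal_measureReal, Measure.restrict_apply' hΩ.measurableSet] at h1
    refine le_trans (measure_mono ?_) h1
    rintro x ⟨hx, hx'⟩
    refine ⟨?_, hx⟩
    change l < abs (mulLog |u x - ustar x|) at hx'
    rwa [abs_of_nonneg (mulLog_nonneg (abs_nonneg _))] at hx'
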